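/- Let $p\ge 1$, and for a symmetric matrix $\theta\in\mathbb R^{p\times p}$ let $f_\theta$ be the probability mass function on $\{0,1\}^p$ with $$f_\theta(x)\propto\exp\Big(\sum_{j}\theta_{jj}x_j+\sum_{i<j}\theta_{ij}x_ix_j\Big).$$ Let $Z\in\{0,1\}^{n\times p}$ have independent rows with mass function $f_{\theta_\star}$ for a symmetric $\theta_\star$, and write $\mathbb E^{(n)}$ for the expectation over $Z$. For $\theta\in\mathbb R^{p\times p}$ (not necessarily symmetric) let $\theta_{\cdot j}$ be its $j$-th column and $$q_{n,\theta}(Z)=\prod_{j=1}^p\prod_{i=1}^n\frac{\exp\big(Z_{ij}(\theta_{jj}+\sum_{k\ne j}\theta_{kj}Z_{ik})\big)}{1+\exp\big(\theta_{jj}+\sum_{k\ne j}\theta_{kj}Z_{ik}\big)}.$$ The quasi-posterior is the probability measure on $\mathbb R^{p\times p}$ $$\check\Pi_{n,d}(d\theta\mid Z)\propto q_{n,\theta}(Z)\prod_{j=1}^p\sum_{\delta\in\{0,1\}^p}\pi_\delta\Big(\frac{\rho}{2}\Big)^{\|\delta\|_0}e^{-\rho\|\theta_{\cdot j}\|_1}\mu_{p,\delta}(d\theta_{\cdot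 j}),\qquad \rho=24\sqrt{n\log p},$$ where $\mu_{p,\delta}$ is the product measure on $\mathbb R^p$ whose $k$-th factor is Lebesgue measure if $\delta_k=1$ and the unit mass at $0$ if $\delta_k=0$. The prior weights are $\pi_\delta=g_{\|\delta\|_0}\binom{p}{\|\delta\|_0}^{-1}$, where $(g_s)_{0\le s\le p}$ is a probability distribution with $$\frac{c_1}{p^{c_3}}g_{s-1}\le g_s\le\frac{c_2}{p^{c_4}}g_{s-1},\qquad 1\le s\le p,$$ for positive constants $c_1,c_2$ and $c_3\ge c_4>0$. For $X\sim f_{\theta_\star}$ let $X_{(j)}$ be $X$ with its $j$-th coordinate replaced by $1$, let $g(x)=\log(1+e^x)$, and let $\mathcal H^{(j)}=\mathbb E\big[g''(\langle\theta_{\star\cdot j},X_{(j)}\rangle)X_{(j)}X_{(j)}'\big]$. Define $$\underline\kappa_2(s)=\min_{j}\inf\Big\{\tfrac{u'\mathcal H^{(j)}u}{\|u\|_2^2}:u\neq0,\ \|u\|_0\le s\Big\},$$ $$\underline\kappa_2=\min_{j}\inf\Big\{\tfrac{u'\mathcal H^{(j)}u}{\|u\|_2^2}:u\ne0,\ \sum_{k:\theta_{\star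 kj}=0}|u_k|\le7\sum_{k:\theta_{\star kj}\ne0}|u_k|\Big\}$$ (with $\inf\emptyset=+\infty$). Let $s_{\star j}=\|\theta_{\star\cdot j}\|_0$, $$\zeta_j=s_{\star j}+\frac4{c_4}+\frac2{c_4}\Big(1+\frac{128}{\underline\kappa_2}+\frac{s_{\star j}}{64(\log p)^2}+\frac{\log(4e)}{\log p}\Big)s_{\star j},$$ $\bar s=\max_j\lceil s_{\star j}+\zeta_j\rceil$ and $\underline\kappa=\underline\kappa(\bar s)=\min(\underline\kappa_2,\underline\kappa_2(\bar s))$. There are universal constants $A_1,A_2\in(0,\infty)$ such that for all $c_1,c_2,c_3,c_4$ as above there is a finite $M_0>2$, depending only on $c_1,c_2,c_3,c_4$, such that the following holds for all $p$ large enough (how large depends only on $c_1,\dots,c_4$), all such $(g_s)$, all symmetric $\theta_\star\in\mathbb R^{p\times p}$ with $\underline\kappa>0$, and all $n$ with $$n\ge A_1\Big(\frac{\bar s}{\underline\kappa(\bar s)}\Big)^2\log p :$$ $$\mathbb E^{(n)}\Big[\check\Pi_{n,d}\Big(\Big\{\theta\in\mathbb R^{p\times p}:\ \max_{1\le j\le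 p}\|\theta_{\cdot j}-\theta_{\star\cdot j}\|_2>\frac{M_0}{\underline\kappa_2(\bar s)}\sqrt{\frac{\bar s\log p}{n}}\Big\}\,\Big|\,Z\Big)\Big]\le 2e^{-A_2n}+\frac{12}{p}.$$ -/

import Mathlib

open MeasureTheory

namespace IsingQuasi

/-- The numerical value of a binary coordinate: a point of `{0,1}^p` is a function
`Fin p → Bool`, and `bit` reads its coordinates as the real numbers `0` and `1`. -/
def bit (b : Bool) : ℝ := if b then 1 else 0

/-! ### Vectors and matrices -/

/-- The number `‖u‖₀` of non-zero components. -/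
noncomputable def nnz {p : ℕ} (u : Fin p → ℝ) : ℕ := (Finset.univ.filter fun k => u k ≠ 0).card

/-- The `ℓ¹` norm `‖u‖₁`. -/
def norm1 {p : ℕ} (u : Fin p → ℝ) : ℝ := ∑ k, |u k|

/-- The Euclidean norm `‖u‖₂`. -/
noncomputable def norm2 {p : ℕ} (u : Fin p → ℝ) : ℝ := Real.sqrt (∑ k, u k ^ 2)

/-- The `j`-th column `θ_{·j}` of a matrix. -/
def column {p : ℕ} (θ : Matrix (Fin p) (Fin p) ℝ) (j : Fin p) : Fin p → ℝ := fun k => θ k j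

/-- The norm `max_j ‖θ_{·j}‖₂` (a supremum over a finite index set). -/
noncomputable def maxColNorm {p : ℕ} (θ : Matrix (Fin p) (Fin p) ℝ) : ℝ :=
  ⨆ j : Fin p, norm2 (column θ j)

/-! ### The Ising model and the law of the data -/

/-- The unnormalized Ising density
`exp (∑_j θ_{jj} x_j + ∑_{i<j} θ_{ij} x_i x_j)`. -/
noncomputable def isingWeight {p : ℕ} (θ : Matrix (Fin p) (Fin p) ℝ) (x : Fin p → Bool) : ℝ :=
  Real.exp (∑ j, θ j j * bit (x j) +
    ∑ i, ∑ j, if i < j then θ i j * bit (x i) * bit (x j) else 0)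

/-- The normalizing constant `Z_θ`. -/
noncomputable def isingConst {p : ℕ} (θ : Matrix (Fin p) (Fin p) ℝ) : ℝ :=
  ∑ x : Fin p → Bool, isingWeight θ x

/-- The Ising probability mass function `f_θ` on `{0,1}^p`. -/
noncomputable def isingDensity {p : ℕ} (θ : Matrix (Fin p) (Fin p) ℝ) (x : Fin p → Bool) : ℝ :=
  isingWeight θ x / isingConst θ

theorem isingWeight_pos {p : ℕ} (θ : Matrix (Fin p) (Fin p) ℝ) (x : Fin p → Bool) :
    0 < isingWeight θ x := Real.exp_pos _

theorem isingConst_pos {p : ℕ} (θ : Matrix (Fin p) (Fin p) ℝ) : 0 < isingConst θ :=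
  Finset.sum_pos (fun x _ => isingWeight_pos θ x) Finset.univ_nonempty

theorem sum_ofReal_isingDensity {p : ℕ} (θ : Matrix (Fin p) (Fin p) ℝ) :
    ∑ x : Fin p → Bool, ENNReal.ofReal (isingDensity θ x) = 1 := by
  have h : ∑ x : Fin p → Bool, isingDensity θ x = 1 := by
    unfold isingDensity
    rw [← Finset.sum_div]
    exact div_self (isingConst_pos θ).ne'
  have hn : ∀ x ∈ (Finset.univ : Finset (Fin p → Bool)), 0 ≤ isingDensity θ x :=
    fun x _ => (div_pos (isingWeight_pos θ x) (isingConst_pos θ)).le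
  rw [← ENNReal.ofReal_sum_of_nonneg hn, h, ENNReal.ofReal_one]

/-- The Ising distribution with mass function `f_θ`. -/
noncomputable def isingPMF {p : ℕ} (θ : Matrix (Fin p) (Fin p) ℝ) : PMF (Fin p → Bool) :=
  PMF.ofFintype (fun x => ENNReal.ofReal (isingDensity θ x)) (sum_ofReal_isingDensity θ)

/-- The law `P^{(n)}_θ` of the data matrix `Z`: its `n` rows are independent, each with mass
function `f_θ`. -/
noncomputable def dataLaw {p : ℕ} (n : ℕ) (θ : Matrix (Fin p) (Fin p) ℝ) :
    Measure (Fin n → Fin p → Bool) :=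
  Measure.pi fun _ => (isingPMF θ).toMeasure

/-! ### The quasi-likelihood, the prior and the quasi-posterior -/

/-- The quasi-likelihood
`q_{n,θ}(z) = ∏_j ∏_i exp (z_{ij} (θ_{jj} + ∑_{k≠j} θ_{kj} z_{ik})) /
(1 + exp (θ_{jj} + ∑_{k≠j} θ_{kj} z_{ik}))`. -/
noncomputable def quasiLik {p n : ℕ} (z : Fin n → Fin p → Bool)
    (θ : Matrix (Fin p) (Fin p) ℝ) : ℝ :=
  ∏ j, ∏ i,
    Real.exp (bit (z i j) * (θ j j + ∑ k ∈ Finset.univ.erase j, θ k j * bit (z i k))) /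
      (1 + Real.exp (θ j j + ∑ k ∈ Finset.univ.erase j, θ k j * bit (z i k)))

/-- The measure `μ_{p,δ}` on `ℝ^p`: Lebesgue measure in the active coordinates, a unit mass at
`0` in the others. A sparsity structure `δ ∈ {0,1}^p` is given by its set of active
coordinates. -/
noncomputable def sparseBase {p : ℕ} (δ : Finset (Fin p)) : Measure (Fin p → ℝ) :=
  Measure.pi fun k => if k ∈ δ then (volume : Measure ℝ) else Measure.dirac 0

/-- The weight `π_δ = g_{‖δ‖₀} / (p choose ‖δ‖₀)`. -/
noncomputable def structWeight {p : ℕ} (g : ℕ → ℝ) (δ : Finset (Fin p)) : ℝ :=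
  g δ.card / (p.choose δ.card : ℝ)

/-- The prior of one column,
`∑_δ π_δ (ρ/2)^{‖δ‖₀} e^{-ρ‖u‖₁} μ_{p,δ}(du)`. -/
noncomputable def columnPrior (p : ℕ) (g : ℕ → ℝ) (ρ : ℝ) : Measure (Fin p → ℝ) :=
  ∑ δ : Finset (Fin p), (sparseBase δ).withDensity fun u =>
    ENNReal.ofReal (structWeight g δ * (ρ / 2) ^ δ.card * Real.exp (-ρ * norm1 u))

/-- The Borel sigma-algebra on matrices, as the product of the Borel sigma-algebras of the
entries. -/
instance matrixMeasurableSpace (p : ℕ) : MeasurableSpace (Matrix (Fin p) (Fin p) ℝ) :=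
  inferInstanceAs (MeasurableSpace (Fin p → Fin p → ℝ))

/-- The prior on `ℝ^{p×p}`: the columns are independent with the prior `columnPrior`. A family
of columns `c` is turned into the matrix whose `(k, j)` entry is `c j k`. -/
noncomputable def matrixPrior (p : ℕ) (g : ℕ → ℝ) (ρ : ℝ) :
    Measure (Matrix (Fin p) (Fin p) ℝ) :=
  (Measure.pi fun _ : Fin p => columnPrior p g ρ).map fun c => Matrix.of fun k j => c j k

/-- The quasi-posterior distribution given the data `z`:
`A ↦ ∫_A q_{n,θ}(z) Π(dθ) / ∫ q_{n,θ}(z) Π(dθ)`. -/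
noncomputable def quasiPosterior {p n : ℕ} (g : ℕ → ℝ) (ρ : ℝ) (z : Fin n → Fin p → Bool) :
    Measure (Matrix (Fin p) (Fin p) ℝ) :=
  let μ := (matrixPrior p g ρ).withDensity fun θ => ENNReal.ofReal (quasiLik z θ)
  (μ Set.univ)⁻¹ • μ

/-- `g_0, …, g_p` is a probability distribution on `{0, …, p}` with
`(c₁ / p^{c₃}) g_{s-1} ≤ g_s ≤ (c₂ / p^{c₄}) g_{s-1}` for `1 ≤ s ≤ p`. -/
structure SparsityPrior (p : ℕ) (c₁ c₂ c₃ c₄ : ℝ) (g : ℕ → ℝ) : Prop where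
  nonneg : ∀ s ≤ p, 0 ≤ g s
  sum_eq_one : ∑ s ∈ Finset.range (p + 1), g s = 1
  lower : ∀ s, 1 ≤ s → s ≤ p → c₁ / (p : ℝ) ^ c₃ * g (s - 1) ≤ g s
  upper : ∀ s, 1 ≤ s → s ≤ p → g s ≤ c₂ / (p : ℝ) ^ c₄ * g (s - 1)

/-- The prior parameter `ρ = 24 √(n log p)`. -/
noncomputable def rho (n p : ℕ) : ℝ := 24 * Real.sqrt (n * Real.log p)

/-! ### Restricted eigenvalues of the conditional information matrices -/

/-- The second derivative `e^x / (1 + e^x)²` of `log (1 + e^x)`. -/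
noncomputable def logisticSecond (x : ℝ) : ℝ := Real.exp x / (1 + Real.exp x) ^ 2

/-- The vector `x_{(j)}`: the point `x` with its `j`-th coordinate replaced by `1`. -/
def plugOne {p : ℕ} (j : Fin p) (x : Fin p → Bool) : Fin p → ℝ :=
  fun k => if k = j then 1 else bit (x k)

/-- The matrix
`H^{(j)} = E[g''(⟨θ_{·j}, X_{(j)}⟩) X_{(j)} X_{(j)}']` for `X` with mass function `f_θ`, where
`g(x) = log (1 + e^x)`. -/
noncomputable def fisher {p : ℕ} (θ : Matrix (Fin p) (Fin p) ℝ) (j : Fin p) :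
    Matrix (Fin p) (Fin p) ℝ :=
  Matrix.of fun s t => ∑ x : Fin p → Bool, isingDensity θ x *
    (logisticSecond (column θ j ⬝ᵥ plugOne j x) * (plugOne j x s * plugOne j x t))

/-- The quotient `u' H^{(j)} u / ‖u‖₂²` as an extended non-negative number (`H^{(j)}` is positive
semidefinite, so the truncation of `ENNReal.ofReal` at zero is never active). -/
noncomputable def rayleigh {p : ℕ} (θ : Matrix (Fin p) (Fin p) ℝ) (j : Fin p)
    (u : Fin p → ℝ) : ENNReal :=
  ENNReal.ofReal ((u ⬝ᵥ (fisher θ j).mulVec u) / norm2 u ^ 2)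

/-- The smallest sparse eigenvalue `κ₂(s)`: the infimum over all `j` and all `u ≠ 0` with
`‖u‖₀ ≤ s`. -/
noncomputable def kappaSparse {p : ℕ} (θ : Matrix (Fin p) (Fin p) ℝ) (s : ℕ) : ENNReal :=
  ⨅ (j : Fin p) (u : Fin p → ℝ) (_ : u ≠ 0 ∧ nnz u ≤ s), rayleigh θ j u

/-- The restricted eigenvalue `κ₂`: the infimum over all `j` and all `u ≠ 0` with
`∑_{k : θ_{kj} = 0} |u_k| ≤ 7 ∑_{k : θ_{kj} ≠ 0} |u_k|` (and `+∞` if there are no such `u`,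
that is, if `θ = 0`). -/
noncomputable def kappaCone {p : ℕ} (θ : Matrix (Fin p) (Fin p) ℝ) : ENNReal :=
  ⨅ (j : Fin p) (u : Fin p → ℝ)
    (_ : u ≠ 0 ∧ ∑ k ∈ Finset.univ.filter (fun k => θ k j = 0), |u k| ≤
      7 * ∑ k ∈ Finset.univ.filter (fun k => θ k j ≠ 0), |u k|), rayleigh θ j u

/-! ### The sparsity levels -/

/-- `ζ_j = s_j + 4/c₄ + (2/c₄) (1 + 128/κ₂ + s_j/(64 (log p)²) + log(4e)/log p) s_j`
with `s_j = ‖θ_{·j}‖₀`; here `128/κ₂` is `0` if `κ₂ = +∞`. -/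
noncomputable def zeta {p : ℕ} (c₄ : ℝ) (θ : Matrix (Fin p) (Fin p) ℝ) (j : Fin p) : ℝ :=
  nnz (column θ j) + 4 / c₄ +
    2 / c₄ * (1 + (128 / kappaCone θ).toReal + nnz (column θ j) / (64 * Real.log p ^ 2)
      + Real.log (4 * Real.exp 1) / Real.log p) * nnz (column θ j)

/-- `s̄ = max_j ⌈s_j + ζ_j⌉`. -/
noncomputable def sBar {p : ℕ} (c₄ : ℝ) (θ : Matrix (Fin p) (Fin p) ℝ) : ℕ :=
  Finset.univ.sup fun j : Fin p => ⌈(nnz (column θ j) : ℝ) + zeta c₄ θ j⌉₊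

/-- `κ = min (κ₂, κ₂(s̄))`. -/
noncomputable def kappaMin {p : ℕ} (c₄ : ℝ) (θ : Matrix (Fin p) (Fin p) ℝ) : ENNReal :=
  min (kappaCone θ) (kappaSparse θ (sBar c₄ θ))

end IsingQuasi

/-!
The quasi-likelihood and the prior factor over the columns of `θ`, so each column can be treated
separately, with log-likelihood `ℓ(u) = ∑ᵢ (Z_ij ⟨u, X_i⟩ - log (1 + exp ⟨u, X_i⟩))`, where `X_i` is
the `i`-th row of `Z` with its `j`-th coordinate replaced by `1`.

Outside an event of probability at most `4 / p`, Hoeffding's inequality bounds all scores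
`|∂_k ℓ(θ_j)|` by `ρ / 4` and brings the empirical information close to its expectation `H^(j)`.
Write `u = θ_j + d` and let `S` be the support of `θ_j`. The logistic link is self-concordant, so
`ℓ(θ_j + d) - ℓ(θ_j) ≤ (ρ / 4) ‖d‖₁ - ½ d' I d / (1 + ‖d‖₁)` with `I` the empirical information.
Suppose this ratio fails to lie below `ρ ‖u‖₁ - ρ ‖θ_j‖₁ - T - (ρ / 4) ‖d‖₁`, where `T` has order
`s̄ log p`. Then either `‖d_{Sᶜ}‖₁ ≥ 7 ‖d_S‖₁` and `‖d‖₁` is small at once, or `d` lies in the cone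
of `κ₂` and the curvature forces `‖d‖₁` to be small. As `κ₂(s̄)` bounds `d' H^(j) d` from below up
to a multiple of `‖d‖₁² / s̄`, it follows that `‖d‖₂` is within the contraction radius.

Outside the radius the prior penalty is therefore only partly compensated by the likelihood, and
the remaining factor `exp (-T - (ρ / 4) ‖d‖₁)` is integrable against the sparse base measures with
total mass `e^(-T) ∑_s g_s 4^s`. Restricting the normalizing integral to the coordinates in `S` and
to `‖d‖₁ ≤ s / ρ` bounds it below by `g_s / binom(p, s)` up to an exponential factor, and the choice
of `T` makes the quotient at most `1 / p²`. A union bound over the columns costs a factor `p`.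
-/

namespace IsingQuasi

/-! ### The logistic function -/

theorem sigmoid_eq_exp_div (x : ℝ) : Real.sigmoid x = Real.exp x / (1 + Real.exp x) := by
  rw [Real.sigmoid_def, Real.exp_neg]
  field_simp
  ring

theorem logisticSecond_eq_sigmoid (x : ℝ) :
    logisticSecond x = Real.sigmoid x * (1 - Real.sigmoid x) := by
  rw [logisticSecond, sigmoid_eq_exp_div]
  field_simp
  ring

theorem logisticSecond_neg (x : ℝ) : logisticSecond (-x) = logisticSecond x := by
  simp only [logisticSecond_eq_sigmoid, Real.sigmoid_neg]
  ring

theorem logisticSecond_nonneg (x : ℝ) : 0 ≤ logisticSecond x := by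
  unfold logisticSecond
  positivity

theorem logisticSecond_le (x : ℝ) : logisticSecond x ≤ 1 / 4 := by
  rw [logisticSecond_eq_sigmoid]
  linarith [sq_nonneg (Real.sigmoid x - 1 / 2)]

theorem hasDerivAt_log_one_add_exp (x : ℝ) :
    HasDerivAt (fun y => Real.log (1 + Real.exp y)) (Real.sigmoid x) x := by
  rw [sigmoid_eq_exp_div]
  exact ((Real.hasDerivAt_exp x).const_add 1).log (by positivity)

/-- The Bregman divergence of `log (1 + e^x)` between `a + h` and `a`. -/
noncomputable def logisticBregman (a h : ℝ) : ℝ :=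
  Real.log (1 + Real.exp (a + h)) - Real.log (1 + Real.exp a) - Real.sigmoid a * h

theorem logisticBregman_zero (a : ℝ) : logisticBregman a 0 = 0 := by
  simp [logisticBregman]

theorem logisticBregman_neg_neg (a h : ℝ) : logisticBregman (-a) (-h) = logisticBregman a h := by
  have log_neg (x : ℝ) : Real.log (1 + Real.exp (-x)) = Real.log (1 + Real.exp x) - x := by
    rw [← Real.log_exp x, ← Real.log_div (by positivity) (by positivity), Real.log_exp,
      Real.exp_neg]
    congr 1
    field_simp
    ring
  rw [logisticBregman, ← neg_add, log_neg, log_neg, Real.sigmoid_neg, logisticBregman]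
  ring

theorem hasDerivAt_logisticBregman (a h : ℝ) :
    HasDerivAt (logisticBregman a) (Real.sigmoid (a + h) - Real.sigmoid a) h := by
  have hlog := (hasDerivAt_log_one_add_exp (a + h)).comp_const_add a h
  exact ((hlog.sub_const (Real.log (1 + Real.exp a))).sub
    ((hasDerivAt_id h).const_mul (Real.sigmoid a))).congr_deriv (by rw [mul_one])

theorem le_of_hasDerivAt_le_of_nonneg {f g f' g' : ℝ → ℝ} (h₀ : f 0 ≤ g 0)
    (hf : ∀ x, 0 ≤ x → HasDerivAt f (f' x) x) (hg : ∀ x, 0 ≤ x → HasDerivAt g (g' x) x)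
    (hle : ∀ x, 0 ≤ x → f' x ≤ g' x) {x : ℝ} (hx : 0 ≤ x) : f x ≤ g x := by
  have hderiv : ∀ y, 0 ≤ y → HasDerivAt (fun z => g z - f z) (g' y - f' y) y :=
    fun y hy => (hg y hy).sub (hf y hy)
  have hmono : MonotoneOn (fun z => g z - f z) (Set.Ici 0) := by
    refine monotoneOn_of_hasDerivWithinAt_nonneg (f' := fun y => g' y - f' y) (convex_Ici 0)
      (fun y hy => (hderiv y hy).continuousAt.continuousWithinAt) (fun y hy => ?_)
      (fun y hy => ?_)
    all_goals rw [interior_Ici] at hy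
    · exact (hderiv y (le_of_lt hy)).hasDerivWithinAt
    · exact sub_nonneg.2 (hle y (le_of_lt hy))
  have := hmono Set.self_mem_Ici hx hx
  dsimp only at this
  linarith

theorem logisticSecond_mul_le_sigmoid_sub (a : ℝ) {h : ℝ} (hh : 0 ≤ h) :
    logisticSecond a * (h / (1 + h)) ≤ Real.sigmoid (a + h) - Real.sigmoid a := by
  have hexp := Real.add_one_le_exp h
  have key : h * (1 + Real.exp a * Real.exp h) ≤
      (1 + h) * ((Real.exp h - 1) * (1 + Real.exp a)) := by
    have h₁ : h * Real.exp h ≤ (1 + h) * (Real.exp h - 1) := by linarith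
    nlinarith [mul_le_mul_of_nonneg_right h₁ (by positivity : 0 ≤ 1 + Real.exp a)]
  rw [logisticSecond, sigmoid_eq_exp_div, sigmoid_eq_exp_div, Real.exp_add,
    div_sub_div _ _ (by positivity) (by positivity), div_mul_div_comm,
    div_le_div_iff₀ (by positivity) (by positivity)]
  nlinarith [mul_le_mul_of_nonneg_left key
    (by positivity : 0 ≤ Real.exp a * (1 + Real.exp a))]

theorem sigmoid_add_sub_le (a : ℝ) {h : ℝ} (hh : 0 ≤ h) :
    Real.sigmoid (a + h) - Real.sigmoid a ≤ h / 4 := by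
  refine le_of_hasDerivAt_le_of_nonneg (f := fun x => Real.sigmoid (a + x) - Real.sigmoid a)
    (by simp) (fun x _ => ((Real.hasDerivAt_sigmoid (a + x)).comp_const_add a x).sub_const _)
    (fun x _ => (hasDerivAt_id x).div_const 4) (fun x _ => ?_) hh
  rw [← logisticSecond_eq_sigmoid]
  exact logisticSecond_le _

theorem hasDerivAt_sq_div_two_mul_one_add {x : ℝ} (hx : 0 ≤ x) :
    HasDerivAt (fun y : ℝ => y ^ 2 / (2 * (1 + y)))
      ((2 * x * (2 * (1 + x)) - x ^ 2 * 2) / (2 * (1 + x)) ^ 2) x := by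
  have hden : HasDerivAt (fun y : ℝ => 2 * (1 + y)) 2 x := by
    simpa using ((hasDerivAt_id x).const_add 1).const_mul 2
  have hnum : HasDerivAt (fun y : ℝ => y ^ 2) (2 * x) x := by simpa using hasDerivAt_pow 2 x
  exact hnum.div hden (by positivity)

theorem logisticSecond_mul_le_logisticBregman (a h : ℝ) :
    logisticSecond a * (h ^ 2 / (2 * (1 + |h|))) ≤ logisticBregman a h := by
  wlog hh : 0 ≤ h generalizing a h
  · simpa only [logisticSecond_neg, neg_sq, abs_neg, logisticBregman_neg_neg] using
      this (-a) (-h) (by linarith)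
  rw [abs_of_nonneg hh]
  refine le_of_hasDerivAt_le_of_nonneg
    (f := fun x => logisticSecond a * (x ^ 2 / (2 * (1 + x)))) (by simp [logisticBregman_zero])
    (fun x hx => (hasDerivAt_sq_div_two_mul_one_add hx).const_mul _)
    (fun x _ => hasDerivAt_logisticBregman a x) (fun x hx => ?_) hh
  have hderiv : (2 * x * (2 * (1 + x)) - x ^ 2 * 2) / (2 * (1 + x)) ^ 2 ≤ x / (1 + x) := by
    rw [div_le_div_iff₀ (by positivity) (by positivity)]
    nlinarith [mul_nonneg hx (by positivity : 0 ≤ 2 * x ^ 2 * (1 + x))]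
  exact (mul_le_mul_of_nonneg_left hderiv (logisticSecond_nonneg a)).trans
    (logisticSecond_mul_le_sigmoid_sub a hx)

theorem logisticBregman_le (a h : ℝ) : logisticBregman a h ≤ h ^ 2 / 8 := by
  wlog hh : 0 ≤ h generalizing a h
  · simpa only [neg_sq, logisticBregman_neg_neg] using this (-a) (-h) (by linarith)
  refine le_of_hasDerivAt_le_of_nonneg (g := fun x => x ^ 2 / 8) (g' := fun x => x / 4)
    (by simp [logisticBregman_zero]) (fun x _ => hasDerivAt_logisticBregman a x) (fun x _ => ?_)
    (fun x hx => sigmoid_add_sub_le a hx) hh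
  exact ((hasDerivAt_pow 2 x).div_const 8).congr_deriv (by norm_num; ring)

/-! ### Sparse vectors -/

section SparseVectors

variable {p : ℕ}

/-- The support of a vector, so that `nnz a` is its cardinality. -/
noncomputable def supp (a : Fin p → ℝ) : Finset (Fin p) := Finset.univ.filter fun k => a k ≠ 0

/-- The partial `ℓ¹` norm of `u` over the coordinates in `S`. -/
def normOn (S : Finset (Fin p)) (u : Fin p → ℝ) : ℝ := ∑ k ∈ S, |u k|

theorem mem_supp {a : Fin p → ℝ} {k : Fin p} : k ∈ supp a ↔ a k ≠ 0 := by simp [supp]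

theorem card_supp (a : Fin p → ℝ) : (supp a).card = nnz a := rfl

theorem norm1_nonneg (u : Fin p → ℝ) : 0 ≤ norm1 u := Finset.sum_nonneg fun _ _ => abs_nonneg _

theorem normOn_nonneg (S : Finset (Fin p)) (u : Fin p → ℝ) : 0 ≤ normOn S u :=
  Finset.sum_nonneg fun _ _ => abs_nonneg _

theorem norm2_sq (u : Fin p → ℝ) : norm2 u ^ 2 = ∑ k, u k ^ 2 :=
  Real.sq_sqrt (Finset.sum_nonneg fun _ _ => sq_nonneg _)

theorem norm2_sq_pos {u : Fin p → ℝ} (hu : u ≠ 0) : 0 < norm2 u ^ 2 := by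
  rw [norm2_sq]
  obtain ⟨k, hk⟩ := Function.ne_iff.1 hu
  exact Finset.sum_pos' (fun _ _ => sq_nonneg _) ⟨k, Finset.mem_univ k, sq_pos_of_ne_zero hk⟩

theorem norm2_single_one_sq (k : Fin p) : norm2 (Pi.single k 1 : Fin p → ℝ) ^ 2 = 1 := by
  simp [norm2_sq, Pi.single_apply]

theorem nnz_single_one (k : Fin p) : nnz (Pi.single k 1 : Fin p → ℝ) = 1 := by
  simp [nnz, Pi.single_apply, Finset.filter_eq']

theorem nnz_sum_single_le {m : ℕ} (κ : Fin m → Fin p) (c : Fin p → ℝ) :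
    nnz (∑ i, Pi.single (κ i) (c (κ i)) : Fin p → ℝ) ≤ m := by
  have hsupp : supp (∑ i, Pi.single (κ i) (c (κ i)) : Fin p → ℝ) ⊆ Finset.univ.image κ := by
    intro k hk
    rw [mem_supp, Finset.sum_apply] at hk
    obtain ⟨i, -, hi⟩ := Finset.exists_ne_zero_of_sum_ne_zero hk
    exact Finset.mem_image.2 ⟨i, Finset.mem_univ i, by_contra fun h =>
      hi (Pi.single_eq_of_ne (Ne.symm h) _)⟩
  exact (Finset.card_le_card hsupp).trans (Finset.card_image_le.trans (by simp))

theorem norm2_sq_le_norm1_sq (u : Fin p → ℝ) : norm2 u ^ 2 ≤ norm1 u ^ 2 := by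
  simpa [norm2_sq, norm1] using Finset.sum_sq_le_sq_sum_of_nonneg (s := Finset.univ)
    (f := fun k => |u k|) (fun k _ => abs_nonneg _)

theorem normOn_add_normOn_compl (S : Finset (Fin p)) (u : Fin p → ℝ) :
    normOn S u + normOn Sᶜ u = norm1 u :=
  Finset.sum_add_sum_compl S _

theorem normOn_supp_sq_le (a u : Fin p → ℝ) : normOn (supp a) u ^ 2 ≤ nnz a * norm2 u ^ 2 := by
  calc normOn (supp a) u ^ 2 ≤ (supp a).card * ∑ k ∈ supp a, |u k| ^ 2 :=
        sq_sum_le_card_mul_sum_sq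
    _ ≤ nnz a * norm2 u ^ 2 := by
        rw [norm2_sq, card_supp]
        simp only [sq_abs]
        gcongr
        exact Finset.subset_univ _

theorem norm1_sub_norm1_add_le (a u : Fin p → ℝ) :
    norm1 a - norm1 (a + u) ≤ normOn (supp a) u - normOn (supp a)ᶜ u := by
  have a_eq_zero {k} (hk : k ∈ (supp a)ᶜ) : a k = 0 := by simpa [mem_supp] using hk
  have h_off_a : normOn (supp a)ᶜ a = 0 :=
    Finset.sum_eq_zero fun k hk => by rw [a_eq_zero hk, abs_zero]
  have h_off : normOn (supp a)ᶜ (a + u) = normOn (supp a)ᶜ u :=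
    Finset.sum_congr rfl fun k hk => by rw [Pi.add_apply, a_eq_zero hk, zero_add]
  have h_on : normOn (supp a) a ≤ normOn (supp a) (a + u) + normOn (supp a) u := by
    unfold normOn
    rw [← Finset.sum_add_distrib]
    refine Finset.sum_le_sum fun k _ => ?_
    simpa using abs_sub (a k + u k) (u k)
  rw [← normOn_add_normOn_compl (supp a) a, ← normOn_add_normOn_compl (supp a) (a + u)]
  linarith

end SparseVectors

/-! ### Sparse eigenvalues and Maurey's empirical method -/

theorem exists_le_sum_mul {ι : Type*} [Fintype ι] {w : ι → ℝ} (hw : ∀ k, 0 ≤ w k)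
    (hw₁ : ∑ k, w k = 1) (f : ι → ℝ) : ∃ k, f k ≤ ∑ k, w k * f k := by
  have hle := Finset.inf_le_centerMass (s := Finset.univ) (f := f) (fun k _ => hw k)
    (by rw [hw₁]; exact one_pos)
  obtain ⟨k, -, hk⟩ := Finset.exists_mem_eq_inf' (Finset.nonempty_of_sum_ne_zero
    (by rw [hw₁]; exact one_ne_zero : ∑ k, w k ≠ 0)) f
  rw [hk, Finset.centerMass_eq_of_sum_1 _ _ hw₁] at hle
  exact ⟨k, hle⟩

/- The right-hand side is the expectation of the left-hand side when the `κ i` are independent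
with law `w`; the samples are drawn one at a time, each no worse than its conditional mean. -/
theorem exists_bilin_sum_le {V ι : Type*} [AddCommGroup V] [Module ℝ V] [Fintype ι]
    (B : V →ₗ[ℝ] V →ₗ[ℝ] ℝ) {w : ι → ℝ} (hw : ∀ k, 0 ≤ w k) (hw₁ : ∑ k, w k = 1) (e : ι → V)
    {u : V} (hu : ∑ k, w k • e k = u) (m : ℕ) (y : V) :
    ∃ κ : Fin m → ι, B (y + ∑ i, e (κ i)) (y + ∑ i, e (κ i)) ≤
      B y y + m * (B y u + B u y) + m * ∑ k, w k * B (e k) (e k) + m * (m - 1) * B u u := by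
  have hright (z : V) : ∑ k, w k * B z (e k) = B z u := by simp [← hu]
  have hleft (z : V) : ∑ k, w k * B (e k) z = B u z := by simp [← hu]
  induction m generalizing y with
  | zero => exact ⟨finZeroElim, by simp⟩
  | succ m ih =>
    let f : ι → ℝ := fun k => B (y + e k) (y + e k) + m * (B (y + e k) u + B u (y + e k))
    have hf : ∑ k, w k * f k = B y y + (m + 1) * (B y u + B u y) + ∑ k, w k * B (e k) (e k) +
        2 * m * B u u := by
      have expand (k : ι) : w k * f k = w k * (B y y + m * (B y u + B u y)) + w k * B y (e k) +
          w k * B (e k) y + w k * B (e k) (e k) +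
          (m * (w k * B (e k) u) + m * (w k * B u (e k))) := by
        simp only [f, map_add, LinearMap.add_apply]
        ring
      simp only [expand, Finset.sum_add_distrib, ← Finset.sum_mul, ← Finset.mul_sum, hright,
        hleft, hw₁]
      ring
    obtain ⟨k, hk⟩ := exists_le_sum_mul hw hw₁ f
    obtain ⟨κ, hκ⟩ := ih (y + e k)
    refine ⟨Fin.cons k κ, ?_⟩
    rw [hf] at hk
    simp only [Fin.sum_univ_succ, Fin.cons_zero, Fin.cons_succ, ← add_assoc]
    push_cast
    linarith

section SparseEigenvalue

variable {p : ℕ}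

open Matrix

theorem dotProduct_mulVec_single (G : Matrix (Fin p) (Fin p) ℝ) (k : Fin p) (c : ℝ) :
    (Pi.single k c : Fin p → ℝ) ⬝ᵥ G *ᵥ (Pi.single k c) = G k k * c ^ 2 := by
  simp [sq, mul_left_comm, mul_comm]

theorem quadForm_add_norm1_sq_nonneg_of_sparse {G : Matrix (Fin p) (Fin p) ℝ} {D : ℝ}
    (hdiag : ∀ k, G k k ≤ D) {m : ℕ} (hm : 1 ≤ m)
    (hsparse : ∀ x : Fin p → ℝ, nnz x ≤ m → 0 ≤ x ⬝ᵥ G *ᵥ x) (u : Fin p → ℝ) :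
    0 ≤ D * norm1 u ^ 2 + (m - 1) * (u ⬝ᵥ G *ᵥ u) := by
  rcases eq_or_ne u 0 with rfl | hu
  · simp [norm1]
  have hL : 0 < norm1 u := by
    refine (norm1_nonneg u).lt_of_ne fun h => ?_
    have := (norm2_sq_pos hu).trans_le (norm2_sq_le_norm1_sq u)
    simp [← h] at this
  -- `u` is the convex combination, with weights `|u k| / ‖u‖₁`, of the vectors `± ‖u‖₁ e_k`
  let c : Fin p → ℝ := fun k => if 0 ≤ u k then norm1 u else -norm1 u
  have hc (k : Fin p) : |u k| / norm1 u * c k = u k := by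
    rcases le_or_gt 0 (u k) with h | h
    · simp only [c, if_pos h, abs_of_nonneg h, div_mul_cancel₀ _ hL.ne']
    · simp only [c, if_neg h.not_ge, abs_of_neg h, mul_neg, div_mul_cancel₀ _ hL.ne', neg_neg]
  have hw₁ : ∑ k, |u k| / norm1 u = 1 := by
    rw [← Finset.sum_div]
    exact div_self hL.ne'
  have hcomb : ∑ k, (|u k| / norm1 u) • (Pi.single k (c k) : Fin p → ℝ) = u := by
    ext i
    simp [Finset.sum_apply, Pi.single_apply, hc]
  obtain ⟨κ, hκ⟩ := exists_bilin_sum_le (Matrix.toLinearMap₂' ℝ G) (fun k => by positivity) hw₁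
    (fun k => Pi.single k (c k)) hcomb m 0
  have hatom (k : Fin p) : G k k * c k ^ 2 ≤ D * norm1 u ^ 2 := by
    have : c k ^ 2 = norm1 u ^ 2 := by simp only [c]; split_ifs <;> ring
    rw [this]
    exact mul_le_mul_of_nonneg_right (hdiag k) (sq_nonneg _)
  have hmean : ∑ k, |u k| / norm1 u * (G k k * c k ^ 2) ≤ D * norm1 u ^ 2 := by
    calc _ ≤ ∑ k, |u k| / norm1 u * (D * norm1 u ^ 2) :=
          Finset.sum_le_sum fun k _ => mul_le_mul_of_nonneg_left (hatom k) (by positivity)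
      _ = D * norm1 u ^ 2 := by rw [← Finset.sum_mul, hw₁, one_mul]
  simp only [Matrix.toLinearMap₂'_apply', zero_add, dotProduct_mulVec_single, zero_dotProduct,
    mulVec_zero, dotProduct_zero, add_zero, mul_zero] at hκ
  have hm₀ : (0 : ℝ) < m := by exact_mod_cast hm
  refine nonneg_of_mul_nonneg_right (a := (m : ℝ)) ?_ hm₀
  linarith [hsparse _ (nnz_sum_single_le κ c), mul_le_mul_of_nonneg_left hmean hm₀.le]

theorem norm2_sq_le_quadForm_add_norm1_sq {H : Matrix (Fin p) (Fin p) ℝ} {D : ℝ}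
    (hdiag : ∀ k, H k k ≤ D) (hpsd : ∀ u : Fin p → ℝ, 0 ≤ u ⬝ᵥ H *ᵥ u) {κ : ℝ} (hκ : 0 ≤ κ)
    {m : ℕ} (hm : 1 ≤ m)
    (hsparse : ∀ x : Fin p → ℝ, nnz x ≤ m → κ * norm2 x ^ 2 ≤ x ⬝ᵥ H *ᵥ x) (u : Fin p → ℝ) :
    κ * norm2 u ^ 2 ≤ u ⬝ᵥ H *ᵥ u + 2 * D * norm1 u ^ 2 / m := by
  rcases isEmpty_or_nonempty (Fin p) with hp | ⟨⟨k₀⟩⟩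
  · simp [norm2_sq, norm1, dotProduct]
  let G : Matrix (Fin p) (Fin p) ℝ := H - κ • 1
  have hG (x : Fin p → ℝ) : x ⬝ᵥ G *ᵥ x = x ⬝ᵥ H *ᵥ x - κ * norm2 x ^ 2 := by
    simp only [G, sub_mulVec, smul_mulVec, one_mulVec, dotProduct_sub, dotProduct_smul, norm2_sq,
      smul_eq_mul]
    simp [dotProduct, sq]
  have hκD : κ ≤ D := by
    have := hsparse (Pi.single k₀ 1) (by rwa [nnz_single_one])
    rw [norm2_single_one_sq, dotProduct_mulVec_single] at this
    linarith [hdiag k₀]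
  have hdiagG (k : Fin p) : G k k ≤ D := by
    have : G k k = H k k - κ := by simp [G]
    linarith [hdiag k]
  have hlarge := quadForm_add_norm1_sq_nonneg_of_sparse hdiagG hm
    (fun x hx => by rw [hG]; linarith [hsparse x hx]) u
  have hsmall : κ * norm2 u ^ 2 ≤ D * norm1 u ^ 2 :=
    mul_le_mul hκD (norm2_sq_le_norm1_sq u) (sq_nonneg _) (hκ.trans hκD)
  have hm₀ : (0 : ℝ) < m := by exact_mod_cast hm
  rw [hG] at hlarge
  rw [← sub_le_iff_le_add', le_div_iff₀ hm₀]
  linarith [hpsd u]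

end SparseEigenvalue

/-! ### From the penalized likelihood inequality to a Euclidean radius -/

/- In this section `a` and `b` are the `ℓ¹` norms of a deviation on and off the true support, `v`
is its Euclidean norm, `q` its quadratic form in the empirical information matrix,
`r = √(log p / n)` and `w = s̄ r`; the curvature bound on the log-likelihood yields
`q / (2 (1 + a + b)) ≤ 36 r a - 12 r b + C w r`. -/

section Radius

variable {c C s sb r w k kc a b q v : ℝ}

/-- The constant in front of `s̄ √(log p / n)` in the `ℓ¹` radius. -/
def l1Const (c C : ℝ) : ℝ := 8 * (1 + 4 * c * (1 + 8 * C) * (36 + C)) + C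

/-- The constant in front of `√(s̄ log p / n) / κ₂(s̄)` in the Euclidean radius. -/
def l2Const (c C : ℝ) : ℝ := 2 * (1 + 8 * C) * (36 * l1Const c C + C) + l1Const c C ^ 2 + 3

theorem l1Const_pos (hc : 0 ≤ c) (hC : 0 ≤ C) : 0 < l1Const c C := by
  unfold l1Const
  positivity

theorem three_le_l2Const (hc : 0 ≤ c) (hC : 0 ≤ C) : 3 ≤ l2Const c C := by
  have h₁ := l1Const_pos hc hC
  have : 0 ≤ 2 * (1 + 8 * C) * (36 * l1Const c C + C) + l1Const c C ^ 2 := by positivity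
  unfold l2Const
  linarith

theorem add_le_of_seven_mul_le (hr : 0 < r) (hq : 0 ≤ q) (ha : 0 ≤ a) (hb : 0 ≤ b)
    (hmain : q / (2 * (1 + (a + b))) ≤ 36 * r * a - 12 * r * b + C * w * r) (hab : 7 * a ≤ b) :
    a + b ≤ C * w := by
  have hq' : 0 ≤ q / (2 * (1 + (a + b))) := by positivity
  have hcone := mul_le_mul_of_nonneg_left hab hr.le
  have : r * (6 * (a + b)) ≤ r * (C * w) := by linarith
  linarith [le_of_mul_le_mul_left this hr]

theorem le_of_le_seven_mul (hC : 0 ≤ C) (hr : 0 ≤ r) (hw : 0 ≤ w) (ha : 0 ≤ a) (hb : 0 ≤ b)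
    (hmain : q / (2 * (1 + (a + b))) ≤ 36 * r * a - 12 * r * b + C * w * r) (hba : b ≤ 7 * a) :
    q ≤ 2 * (1 + 8 * a) * (36 * r * a + C * w * r) := by
  rw [div_le_iff₀ (by positivity)] at hmain
  calc q ≤ (36 * r * a - 12 * r * b + C * w * r) * (2 * (1 + (a + b))) := hmain
    _ ≤ (36 * r * a + C * w * r) * (2 * (1 + 8 * a)) := by
        gcongr
        · linarith [mul_nonneg hr hb]
        · linarith
    _ = 2 * (1 + 8 * a) * (36 * r * a + C * w * r) := by ring

theorem mul_sq_le_two_mul_of_cone (hk : 0 ≤ k) (hkc : k ≤ kc) (hsb : 0 < sb) (hs : 0 ≤ s)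
    (hssb : 2 * s ≤ sb) (ha : 0 ≤ a) (hb : 0 ≤ b) (hba : b ≤ 7 * a) (hav : a ^ 2 ≤ s * v ^ 2)
    (hcone : kc * v ^ 2 ≤ q + k * (a + b) ^ 2 / (64 * sb)) : kc * a ^ 2 ≤ 2 * s * q := by
  have hv := mul_le_mul_of_nonneg_right hssb (sq_nonneg v)
  have hkv := mul_le_mul_of_nonneg_right hkc (sq_nonneg v)
  have hab : (a + b) ^ 2 ≤ 32 * sb * v ^ 2 := by
    have : (a + b) ^ 2 ≤ (8 * a) ^ 2 := by gcongr; linarith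
    linarith
  have habsorb : k * (a + b) ^ 2 / (64 * sb) ≤ k * v ^ 2 / 2 := by
    rw [div_le_div_iff₀ (by positivity) (by norm_num)]
    linarith [mul_le_mul_of_nonneg_left hab hk]
  calc kc * a ^ 2 ≤ kc * (s * v ^ 2) := mul_le_mul_of_nonneg_left hav (hk.trans hkc)
    _ = s * (kc * v ^ 2) := by ring
    _ ≤ s * (2 * q) := mul_le_mul_of_nonneg_left (by linarith) hs
    _ = 2 * s * q := by ring

theorem le_of_quadratic_growth (hC : 1 ≤ C) (hkc : 0 < kc) (hs : 0 ≤ s) (hr : 0 ≤ r)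
    (hsr : s * r ≤ kc / 2592) (hw₀ : 0 ≤ w) (hw : w ≤ 1) (hquad : kc * a ^ 2 ≤ 2 * s * q)
    (hq : q ≤ 2 * (1 + 8 * a) * (36 * r * a + C * w * r)) : a ≤ C := by
  by_contra! hCa
  have ha : 1 < a := hC.trans_lt hCa
  have hstep : kc * a * a ≤ 36 * (s * r) * (36 * a + C * w) * a := by
    calc kc * a * a = kc * a ^ 2 := by ring
      _ ≤ 2 * s * q := hquad
      _ ≤ 2 * s * (2 * (9 * a) * (36 * r * a + C * w * r)) := by
          gcongr
          exact hq.trans (by gcongr; linarith)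
      _ = 36 * (s * r) * (36 * a + C * w) * a := by ring
  have hlin : kc * a ≤ 36 * (kc / 2592) * (36 * a + C * 1) := by
    refine (le_of_mul_le_mul_right hstep (by linarith)).trans ?_
    gcongr
  have : kc * (a / 2) ≤ kc * (C / 72) := by linarith
  linarith [le_of_mul_le_mul_left this hkc]

theorem le_mul_of_quadratic_growth (hC : 0 ≤ C) (hc : 0 ≤ c) (hkc : 0 < kc) (hs : 0 ≤ s)
    (hr : 0 ≤ r) (hscale : s ≤ c * sb * kc) (ha : 0 ≤ a) (haC : a ≤ C) (hw : 0 < w)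
    (hwr : w = sb * r) (hquad : kc * a ^ 2 ≤ 2 * s * q)
    (hq : q ≤ 2 * (1 + 8 * a) * (36 * r * a + C * w * r)) :
    a ≤ (1 + 4 * c * (1 + 8 * C) * (36 + C)) * w := by
  by_contra! hlt
  have hwa : w ≤ a := by
    have : 0 ≤ 4 * c * (1 + 8 * C) * (36 + C) * w := by positivity
    linarith
  have hsq : kc * (a * a) ≤ kc * (4 * c * (1 + 8 * C) * (36 + C) * w * a) := by
    calc kc * (a * a) = kc * a ^ 2 := by ring
      _ ≤ 2 * s * q := hquad
      _ ≤ 2 * s * (2 * (1 + 8 * C) * (36 * r * a + C * a * r)) := by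
          gcongr
          exact hq.trans (by gcongr)
      _ = 4 * s * ((1 + 8 * C) * (36 + C) * (r * a)) := by ring
      _ ≤ 4 * (c * sb * kc) * ((1 + 8 * C) * (36 + C) * (r * a)) := by gcongr
      _ = kc * (4 * c * (1 + 8 * C) * (36 + C) * w * a) := by rw [hwr]; ring
  have := le_of_mul_le_mul_right (le_of_mul_le_mul_left hsq hkc) (hw.trans_le hwa)
  linarith

theorem mul_sq_le_of_add_le {ks K : ℝ} (hC : 0 ≤ C) (hsb : 0 < sb) (hr : 0 < r)
    (ha : 0 ≤ a) (hb : 0 ≤ b) (hLC : a + b ≤ 8 * C) (hLw : a + b ≤ K * (sb * r))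
    (htransfer : ks * v ^ 2 ≤ q + (a + b) ^ 2 / sb)
    (hmain : q / (2 * (1 + (a + b))) ≤ 36 * r * a - 12 * r * b + C * (sb * r) * r) :
    ks * v ^ 2 ≤ (2 * (1 + 8 * C) * (36 * K + C) + K ^ 2) * (sb * r ^ 2) := by
  have hK : 0 ≤ K :=
    nonneg_of_mul_nonneg_left ((add_nonneg ha hb).trans hLw) (mul_pos hsb hr)
  have hq : q ≤ 2 * (1 + 8 * C) * (36 * K + C) * (sb * r ^ 2) := by
    rw [div_le_iff₀ (by positivity)] at hmain
    calc q ≤ (36 * r * a - 12 * r * b + C * (sb * r) * r) * (2 * (1 + (a + b))) := hmain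
      _ ≤ (36 * r * (a + b) + C * (sb * r) * r) * (2 * (1 + (a + b))) := by
          gcongr
          linarith [mul_nonneg hr.le hb]
      _ ≤ (36 * r * (K * (sb * r)) + C * (sb * r) * r) * (2 * (1 + 8 * C)) := by gcongr
      _ = 2 * (1 + 8 * C) * (36 * K + C) * (sb * r ^ 2) := by ring
  have hL : (a + b) ^ 2 / sb ≤ K ^ 2 * (sb * r ^ 2) := by
    rw [div_le_iff₀ hsb]
    calc (a + b) ^ 2 ≤ (K * (sb * r)) ^ 2 := by gcongr
      _ = K ^ 2 * (sb * r ^ 2) * sb := by ring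
  linarith

theorem le_radius_of_mul_sq_le {ks D : ℝ} (hks : 0 < ks) (hks' : ks ≤ 1 / 4) (hsb : 0 ≤ sb)
    (hr : 0 ≤ r) (hD : 0 ≤ D) (hv : ks * v ^ 2 ≤ D * (sb * r ^ 2)) :
    v ≤ (D + 3) / ks * (Real.sqrt sb * r) := by
  rw [div_mul_eq_mul_div, le_div_iff₀ hks]
  refine le_of_sq_le_sq ?_ (by positivity)
  calc (v * ks) ^ 2 = ks * (ks * v ^ 2) := by ring
    _ ≤ 1 / 4 * (D * (sb * r ^ 2)) := by gcongr
    _ ≤ (D + 3) ^ 2 * (sb * r ^ 2) := by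
        rw [← mul_assoc]
        gcongr
        nlinarith
    _ = ((D + 3) * (Real.sqrt sb * r)) ^ 2 := by rw [mul_pow, mul_pow, Real.sq_sqrt hsb]

theorem le_l2Const_mul {ks : ℝ} (hc : 0 ≤ c) (hC : 1 ≤ C) (hk : 0 < k) (hkks : k ≤ ks)
    (hks : ks ≤ 1 / 4) (hr : 0 < r) (hsb : 0 < sb) (hs : 0 ≤ s) (hssb : 2 * s ≤ sb)
    (hsr : sb * r ≤ k / 1296) (ha : 0 ≤ a) (hb : 0 ≤ b) (hav : a ^ 2 ≤ s * v ^ 2) (hq : 0 ≤ q)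
    (hcone : b < 7 * a → ∃ kc, k ≤ kc ∧ s ≤ c * sb * kc ∧
      kc * v ^ 2 ≤ q + k * (a + b) ^ 2 / (64 * sb))
    (htransfer : ks * v ^ 2 ≤ q + (a + b) ^ 2 / sb)
    (hmain : q / (2 * (1 + (a + b))) ≤ 36 * r * a - 12 * r * b + C * (sb * r) * r) :
    v ≤ l2Const c C / ks * (Real.sqrt sb * r) := by
  have hw : 0 < sb * r := mul_pos hsb hr
  have hw₁ : sb * r ≤ 1 := by linarith
  have hC₀ : 0 ≤ C := zero_le_one.trans hC
  have hl1 : a + b ≤ 8 * C ∧ a + b ≤ l1Const c C * (sb * r) := by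
    rcases le_or_gt (7 * a) b with hab | hba
    · have hL := add_le_of_seven_mul_le hr hq ha hb hmain hab
      refine ⟨hL.trans ((mul_le_of_le_one_right hC₀ hw₁).trans (by linarith)), hL.trans ?_⟩
      refine mul_le_mul_of_nonneg_right (le_add_of_nonneg_left ?_) hw.le
      positivity
    · obtain ⟨kc, hkkc, hscale, hcurv⟩ := hcone hba
      have hkc : 0 < kc := hk.trans_le hkkc
      have hquad := mul_sq_le_two_mul_of_cone hk.le hkkc hsb hs hssb ha hb hba.le hav hcurv
      have hq' := le_of_le_seven_mul hC₀ hr.le hw.le ha hb hmain hba.le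
      have haC : a ≤ C := le_of_quadratic_growth hC hkc hs hr.le
        (by linarith [mul_le_mul_of_nonneg_right hssb hr.le]) hw.le hw₁ hquad hq'
      have haw := le_mul_of_quadratic_growth hC₀ hc hkc hs hr.le hscale ha haC hw rfl hquad hq'
      refine ⟨by linarith, ?_⟩
      unfold l1Const
      linarith [mul_nonneg hC₀ hw.le]
  have hl1C := l1Const_pos hc hC₀
  exact le_radius_of_mul_sq_le (hk.trans_le hkks) hks hsb.le hr.le (by positivity)
    (mul_sq_le_of_add_le hC₀ hsb hr ha hb hl1.1 hl1.2 htransfer hmain)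

end Radius

/-! ### The prior of a column -/

section ColumnPrior

theorem lintegral_pi_prod_eq_prod {n : ℕ} {E : Fin n → Type*} {mE : ∀ i, MeasurableSpace (E i)}
    {μ : (i : Fin n) → Measure (E i)} [∀ i, SigmaFinite (μ i)]
    {f : (i : Fin n) → E i → ENNReal} (hf : ∀ i, Measurable (f i)) :
    ∫⁻ x, ∏ i, f i (x i) ∂(Measure.pi μ) = ∏ i, ∫⁻ x, f i x ∂(μ i) := by
  induction n with
  | zero => simp
  | succ n ih =>
    have hprod : ∀ {m : ℕ} {E : Fin m → Type _} {mE : ∀ i, MeasurableSpace (E i)}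
        {f : (i : Fin m) → E i → ENNReal} (_ : ∀ i, Measurable (f i)),
        Measurable fun x : (i : Fin m) → E i => ∏ i, f i (x i) :=
      fun hf => Finset.measurable_prod _ fun i _ => (hf i).comp (measurable_pi_apply i)
    rw [← (measurePreserving_piFinSuccAbove μ 0).symm.lintegral_comp (hprod hf)]
    simp_rw [Fin.prod_univ_succ]
    rw [← ih fun i => hf i.succ,
      ← lintegral_prod_mul (hf 0).aemeasurable (hprod fun i => hf i.succ).aemeasurable]
    rfl

theorem lintegral_exp_neg_mul_abs_sub {b : ℝ} (hb : 0 < b) (a : ℝ) :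
    ∫⁻ x : ℝ, ENNReal.ofReal (Real.exp (-b * |x - a|)) = ENNReal.ofReal (2 / b) := by
  rw [lintegral_sub_right_eq_self (fun x => ENNReal.ofReal (Real.exp (-b * |x|))) a]
  have hint : ∫ x : ℝ, Real.exp (-b * |x|) = 2 / b := by
    rw [integral_comp_abs (f := fun x => Real.exp (-b * x)), integral_exp_mul_Ioi (by linarith) 0]
    simp only [mul_zero, Real.exp_zero]
    ring
  have hintegrable : Integrable fun x : ℝ => Real.exp (-b * |x|) :=
    Integrable.of_integral_ne_zero (by rw [hint]; positivity)
  rw [← ofReal_integral_eq_lintegral_ofReal hintegrable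
    (Filter.Eventually.of_forall fun _ => (Real.exp_pos _).le), hint]

variable {p : ℕ}

instance sigmaFinite_ite_volume_dirac (δ : Finset (Fin p)) (k : Fin p) :
    SigmaFinite (if k ∈ δ then (volume : Measure ℝ) else Measure.dirac 0) := by
  split_ifs <;> infer_instance

instance sigmaFinite_sparseBase (δ : Finset (Fin p)) : SigmaFinite (sparseBase δ) := by
  unfold sparseBase
  infer_instance

theorem measurable_norm1 : Measurable (norm1 : (Fin p → ℝ) → ℝ) :=
  Finset.measurable_sum _ fun k _ => (measurable_pi_apply k).abs

theorem measurable_norm2 : Measurable (norm2 : (Fin p → ℝ) → ℝ) :=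
  (Finset.measurable_sum _ fun k _ => (measurable_pi_apply k).pow_const 2).sqrt

theorem norm1_le_add_norm1_sub (a u : Fin p → ℝ) : norm1 u ≤ norm1 a + norm1 (u - a) := by
  unfold norm1
  rw [← Finset.sum_add_distrib]
  exact Finset.sum_le_sum fun k _ => by simpa using abs_add_le (a k) (u k - a k)

theorem sum_structWeight_mul_pow (g : ℕ → ℝ) (c : ℝ) :
    ∑ δ : Finset (Fin p), structWeight g δ * c ^ δ.card =
      ∑ m ∈ Finset.range (p + 1), g m * c ^ m := by
  have hcard := Finset.sum_powerset_apply_card (x := (Finset.univ : Finset (Fin p)))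
    (fun m => g m / (p.choose m : ℝ) * c ^ m)
  rw [Finset.powerset_univ, Finset.card_univ, Fintype.card_fin] at hcard
  unfold structWeight
  rw [hcard]
  refine Finset.sum_congr rfl fun m hm => ?_
  have hchoose : (p.choose m : ℝ) ≠ 0 :=
    Nat.cast_ne_zero.2 (Nat.choose_pos (Finset.mem_range_succ_iff.1 hm)).ne'
  rw [nsmul_eq_mul]
  field_simp

theorem structWeight_nonneg {g : ℕ → ℝ} (hg : ∀ s ≤ p, 0 ≤ g s) (δ : Finset (Fin p)) :
    0 ≤ structWeight g δ :=
  div_nonneg (hg _ (by simpa using Finset.card_le_univ δ)) (Nat.cast_nonneg _)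

theorem measurable_columnPrior_density (g : ℕ → ℝ) (ρ : ℝ) (δ : Finset (Fin p)) :
    Measurable fun u : Fin p → ℝ =>
      ENNReal.ofReal (structWeight g δ * (ρ / 2) ^ δ.card * Real.exp (-ρ * norm1 u)) :=
  ((measurable_norm1.const_mul _).exp.const_mul _).ennreal_ofReal

instance sigmaFinite_columnPrior (g : ℕ → ℝ) (ρ : ℝ) : SigmaFinite (columnPrior p g ρ) := by
  have hfactor : ∀ δ : Finset (Fin p), SigmaFinite ((sparseBase δ).withDensity fun u =>
      ENNReal.ofReal (structWeight g δ * (ρ / 2) ^ δ.card * Real.exp (-ρ * norm1 u))) :=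
    fun δ => SigmaFinite.withDensity_of_ne_top (ae_of_all _ fun _ => ENNReal.ofReal_ne_top)
  unfold columnPrior
  rw [← Measure.sum_fintype]
  infer_instance

theorem lintegral_columnPrior (g : ℕ → ℝ) (ρ : ℝ) (f : (Fin p → ℝ) → ENNReal) :
    ∫⁻ u, f u ∂(columnPrior p g ρ) = ∑ δ : Finset (Fin p), ∫⁻ u,
      ENNReal.ofReal (structWeight g δ * (ρ / 2) ^ δ.card * Real.exp (-ρ * norm1 u)) * f u
        ∂(sparseBase δ) := by
  unfold columnPrior
  rw [lintegral_finsetSum_measure]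
  exact Finset.sum_congr rfl fun δ _ => lintegral_withDensity_eq_lintegral_mul_non_measurable _
    (measurable_columnPrior_density g ρ δ) (ae_of_all _ fun _ => ENNReal.ofReal_lt_top) f

theorem lintegral_sparseBase_exp_neg_mul_norm1_le (δ : Finset (Fin p)) {b : ℝ} (hb : 0 < b)
    (a : Fin p → ℝ) :
    ∫⁻ u, ENNReal.ofReal (Real.exp (-b * norm1 (u - a))) ∂(sparseBase δ) ≤
      ENNReal.ofReal ((2 / b) ^ δ.card) := by
  have hprod : ∀ u : Fin p → ℝ, ENNReal.ofReal (Real.exp (-b * norm1 (u - a))) =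
      ∏ k, ENNReal.ofReal (Real.exp (-b * |u k - a k|)) := by
    intro u
    rw [← ENNReal.ofReal_prod_of_nonneg fun _ _ => (Real.exp_pos _).le, ← Real.exp_sum,
      ← Finset.mul_sum]
    rfl
  have hfactor : ∀ k : Fin p, ∫⁻ x, ENNReal.ofReal (Real.exp (-b * |x - a k|))
      ∂(if k ∈ δ then (volume : Measure ℝ) else Measure.dirac 0) ≤
      if k ∈ δ then ENNReal.ofReal (2 / b) else 1 := by
    intro k
    split_ifs
    · exact (lintegral_exp_neg_mul_abs_sub hb (a k)).le
    · rw [lintegral_dirac, ENNReal.ofReal_le_one, Real.exp_le_one_iff, neg_mul]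
      exact neg_nonpos.2 (by positivity)
  calc ∫⁻ u, ENNReal.ofReal (Real.exp (-b * norm1 (u - a))) ∂(sparseBase δ)
      = ∏ k, ∫⁻ x, ENNReal.ofReal (Real.exp (-b * |x - a k|))
          ∂(if k ∈ δ then (volume : Measure ℝ) else Measure.dirac 0) := by
        simp_rw [hprod]
        exact lintegral_pi_prod_eq_prod (f := fun k x => ENNReal.ofReal (Real.exp (-b * |x - a k|)))
          fun k => by fun_prop
    _ ≤ ∏ k, if k ∈ δ then ENNReal.ofReal (2 / b) else 1 :=
        Finset.prod_le_prod' fun k _ => hfactor k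
    _ = ENNReal.ofReal ((2 / b) ^ δ.card) := by
        rw [Finset.prod_ite_mem, Finset.univ_inter, Finset.prod_const,
          ENNReal.ofReal_pow (by positivity)]

theorem setLIntegral_exp_columnPrior_le {g : ℕ → ℝ} (hg : ∀ s ≤ p, 0 ≤ g s) {ρ : ℝ} (hρ : 0 < ρ)
    {L : (Fin p → ℝ) → ℝ} {a : Fin p → ℝ} {T : ℝ} {A : Set (Fin p → ℝ)} (hA : MeasurableSet A)
    (hL : ∀ u ∈ A, L u - L a ≤ ρ * norm1 u - ρ * norm1 a - T - ρ / 4 * norm1 (u - a)) :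
    ∫⁻ u in A, ENNReal.ofReal (Real.exp (L u)) ∂(columnPrior p g ρ) ≤
      ENNReal.ofReal (Real.exp (L a - ρ * norm1 a - T) *
        ∑ m ∈ Finset.range (p + 1), g m * 4 ^ m) := by
  rw [← lintegral_indicator hA, lintegral_columnPrior, ← sum_structWeight_mul_pow, Finset.mul_sum,
    ENNReal.ofReal_sum_of_nonneg fun δ _ => mul_nonneg (Real.exp_pos _).le
      (mul_nonneg (structWeight_nonneg hg δ) (by positivity))]
  refine Finset.sum_le_sum fun δ _ => ?_
  have hw := structWeight_nonneg hg δ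
  set c := structWeight g δ * (ρ / 2) ^ δ.card with hc
  set E := Real.exp (L a - ρ * norm1 a - T) with hE
  calc ∫⁻ u, ENNReal.ofReal (c * Real.exp (-ρ * norm1 u)) *
        A.indicator (fun u => ENNReal.ofReal (Real.exp (L u))) u ∂(sparseBase δ)
      ≤ ∫⁻ u, ENNReal.ofReal (c * E) *
          ENNReal.ofReal (Real.exp (-(ρ / 4) * norm1 (u - a))) ∂(sparseBase δ) := by
        refine lintegral_mono fun u => ?_
        by_cases hu : u ∈ A
        · simp only [Set.indicator_of_mem hu]
          rw [← ENNReal.ofReal_mul (by positivity), ← ENNReal.ofReal_mul (by positivity),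
            mul_assoc, mul_assoc c, hE, ← Real.exp_add, ← Real.exp_add]
          gcongr ENNReal.ofReal (c * Real.exp ?_)
          linarith [hL u hu]
        · simp [Set.indicator_of_notMem hu]
    _ ≤ ENNReal.ofReal (c * E) * ENNReal.ofReal ((2 / (ρ / 4)) ^ δ.card) := by
        rw [lintegral_const_mul' _ _ ENNReal.ofReal_ne_top]
        gcongr
        exact lintegral_sparseBase_exp_neg_mul_norm1_le δ (by positivity) a
    _ = ENNReal.ofReal (E * (structWeight g δ * 4 ^ δ.card)) := by
        have hpow : (ρ / 2) ^ δ.card * (2 / (ρ / 4)) ^ δ.card = 4 ^ δ.card := by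
          rw [← mul_pow]
          congr 1
          field_simp
        rw [← ENNReal.ofReal_mul (by positivity), ← hpow, hc]
        ring_nf

/-- The vectors with the support of `a` whose coordinates are `ε`-close to those of `a`: a box in
the coordinate subspace of `a`, on which the prior mass near `a` is bounded below. -/
def supportBox (a : Fin p → ℝ) (ε : ℝ) : Set (Fin p → ℝ) :=
  Set.univ.pi fun k => Metric.closedBall (a k) (if k ∈ supp a then ε else 0)

theorem measurableSet_supportBox (a : Fin p → ℝ) (ε : ℝ) : MeasurableSet (supportBox a ε) :=
  MeasurableSet.univ_pi fun _ => Metric.isClosed_closedBall.measurableSet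

theorem sparseBase_supportBox (a : Fin p → ℝ) {ε : ℝ} (hε : 0 ≤ ε) :
    sparseBase (supp a) (supportBox a ε) = ENNReal.ofReal ((2 * ε) ^ nnz a) := by
  have hfactor : ∀ k, (if k ∈ supp a then (volume : Measure ℝ) else Measure.dirac 0)
      (Metric.closedBall (a k) (if k ∈ supp a then ε else 0)) =
      if k ∈ supp a then ENNReal.ofReal (2 * ε) else 1 := by
    intro k
    by_cases hk : k ∈ supp a
    · simp only [if_pos hk, Real.volume_closedBall]
    · have hzero : a k = 0 := by simpa [mem_supp] using hk
      simp [hk, hzero]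
  rw [sparseBase, supportBox, Measure.pi_pi, Finset.prod_congr rfl fun k _ => hfactor k,
    Finset.prod_ite_mem, Finset.univ_inter, Finset.prod_const, card_supp,
    ENNReal.ofReal_pow (by positivity)]

theorem norm1_sub_le_of_mem_supportBox {a u : Fin p → ℝ} {ε : ℝ} (hu : u ∈ supportBox a ε) :
    norm1 (u - a) ≤ nnz a * ε := by
  calc norm1 (u - a) ≤ ∑ k, if k ∈ supp a then ε else 0 :=
        Finset.sum_le_sum fun k _ => hu k (Set.mem_univ k)
    _ = nnz a * ε := by
        rw [Finset.sum_ite_mem, Finset.univ_inter, Finset.sum_const, card_supp, nsmul_eq_mul]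

theorem le_lintegral_exp_columnPrior {g : ℕ → ℝ} (hg : ∀ s ≤ p, 0 ≤ g s) {ρ : ℝ} (hρ : 0 < ρ)
    {L : (Fin p → ℝ) → ℝ} {a : Fin p → ℝ} {b : ℝ}
    (hL : ∀ u, norm1 (u - a) ≤ nnz a / ρ → L a - b ≤ L u) :
    ENNReal.ofReal (Real.exp (L a - ρ * norm1 a - b - nnz a) * (g (nnz a) / p.choose (nnz a))) ≤
      ∫⁻ u, ENNReal.ofReal (Real.exp (L u)) ∂(columnPrior p g ρ) := by
  rw [lintegral_columnPrior]
  refine le_trans ?_ (Finset.single_le_sum (f := fun δ : Finset (Fin p) => ∫⁻ u,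
      ENNReal.ofReal (structWeight g δ * (ρ / 2) ^ δ.card * Real.exp (-ρ * norm1 u)) *
        ENNReal.ofReal (Real.exp (L u)) ∂(sparseBase δ))
      (fun _ _ => zero_le) (Finset.mem_univ (supp a)))
  have hw := structWeight_nonneg hg (supp a)
  set c := structWeight g (supp a) * (ρ / 2) ^ (supp a).card with hc
  set E := Real.exp (L a - ρ * norm1 a - b - nnz a) with hE
  calc ENNReal.ofReal (E * (g (nnz a) / p.choose (nnz a)))
      = ENNReal.ofReal (c * E) * ENNReal.ofReal ((2 * (1 / ρ)) ^ nnz a) := by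
        have hpow : (ρ / 2) ^ nnz a * (2 * (1 / ρ)) ^ nnz a = 1 := by
          rw [← mul_pow, show ρ / 2 * (2 * (1 / ρ)) = 1 by field_simp, one_pow]
        rw [← ENNReal.ofReal_mul (by positivity), hc, card_supp, structWeight, card_supp]
        congr 1
        linear_combination -(g (nnz a) / p.choose (nnz a)) * E * hpow
    _ = ∫⁻ _ in supportBox a (1 / ρ), ENNReal.ofReal (c * E) ∂(sparseBase (supp a)) := by
        rw [setLIntegral_const, sparseBase_supportBox a (by positivity)]
    _ ≤ ∫⁻ u in supportBox a (1 / ρ), ENNReal.ofReal (c * Real.exp (-ρ * norm1 u)) *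
          ENNReal.ofReal (Real.exp (L u)) ∂(sparseBase (supp a)) := by
        refine setLIntegral_mono' (measurableSet_supportBox a _) fun u hu => ?_
        have hnear : norm1 (u - a) ≤ nnz a / ρ := by
          simpa [div_eq_mul_inv] using norm1_sub_le_of_mem_supportBox hu
        have hnorm : ρ * norm1 u ≤ ρ * norm1 a + nnz a := by
          calc ρ * norm1 u ≤ ρ * (norm1 a + nnz a / ρ) := by
                gcongr
                exact (norm1_le_add_norm1_sub a u).trans (by gcongr)
            _ = ρ * norm1 a + nnz a := by field_simp
        rw [← ENNReal.ofReal_mul (by positivity), mul_assoc c, hE, ← Real.exp_add]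
        gcongr
        linarith [hL u hnear]
    _ ≤ ∫⁻ u, ENNReal.ofReal (c * Real.exp (-ρ * norm1 u)) * ENNReal.ofReal (Real.exp (L u))
          ∂(sparseBase (supp a)) := setLIntegral_le_lintegral _ _

theorem setLIntegral_exp_columnPrior_le_mul {g : ℕ → ℝ} (hg : ∀ s ≤ p, 0 ≤ g s) {ρ : ℝ}
    (hρ : 0 < ρ) {L : (Fin p → ℝ) → ℝ} {a : Fin p → ℝ} {b T ε : ℝ} (hε : 0 ≤ ε)
    {A : Set (Fin p → ℝ)} (hA : MeasurableSet A)
    (hlow : ∀ u, norm1 (u - a) ≤ nnz a / ρ → L a - b ≤ L u)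
    (hup : ∀ u ∈ A, L u - L a ≤ ρ * norm1 u - ρ * norm1 a - T - ρ / 4 * norm1 (u - a))
    (hprior : Real.exp (-T) * ∑ m ∈ Finset.range (p + 1), g m * 4 ^ m ≤
      ε * (Real.exp (-b - nnz a) * (g (nnz a) / p.choose (nnz a)))) :
    ∫⁻ u in A, ENNReal.ofReal (Real.exp (L u)) ∂(columnPrior p g ρ) ≤
      ENNReal.ofReal ε * ∫⁻ u, ENNReal.ofReal (Real.exp (L u)) ∂(columnPrior p g ρ) := by
  have hreal : Real.exp (L a - ρ * norm1 a - T) * ∑ m ∈ Finset.range (p + 1), g m * 4 ^ m ≤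
      ε * (Real.exp (L a - ρ * norm1 a - b - nnz a) * (g (nnz a) / p.choose (nnz a))) := by
    rw [sub_sub _ b, sub_eq_add_neg _ T, sub_eq_add_neg _ (b + _), Real.exp_add, Real.exp_add,
      neg_add' b]
    linarith [mul_le_mul_of_nonneg_left hprior (Real.exp_pos (L a - ρ * norm1 a)).le]
  calc ∫⁻ u in A, ENNReal.ofReal (Real.exp (L u)) ∂(columnPrior p g ρ)
      ≤ _ := setLIntegral_exp_columnPrior_le hg hρ hA hup
    _ ≤ _ := ENNReal.ofReal_le_ofReal hreal
    _ = _ := ENNReal.ofReal_mul hε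
    _ ≤ _ := by
        gcongr
        exact le_lintegral_exp_columnPrior hg hρ hlow

end ColumnPrior

/-! ### The conditional log-likelihoods -/

section LogLikelihood

open Matrix

theorem bit_mem_Icc (b : Bool) : bit b ∈ Set.Icc (0 : ℝ) 1 := by cases b <;> simp [bit]

variable {p : ℕ}

theorem plugOne_mem_Icc (j : Fin p) (x : Fin p → Bool) (k : Fin p) :
    plugOne j x k ∈ Set.Icc (0 : ℝ) 1 := by
  unfold plugOne
  split_ifs
  · simp
  · exact bit_mem_Icc _

theorem abs_plugOne_le_one (j : Fin p) (x : Fin p → Bool) (k : Fin p) : |plugOne j x k| ≤ 1 := by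
  rw [abs_of_nonneg (plugOne_mem_Icc j x k).1]
  exact (plugOne_mem_Icc j x k).2

theorem abs_dotProduct_le_mul_norm1 (u : Fin p → ℝ) {v : Fin p → ℝ} {l : ℝ}
    (hv : ∀ k, |v k| ≤ l) : |u ⬝ᵥ v| ≤ l * norm1 u := by
  calc |u ⬝ᵥ v| ≤ ∑ k, |u k * v k| := Finset.abs_sum_le_sum_abs _ _
    _ ≤ ∑ k, l * |u k| := Finset.sum_le_sum fun k _ => by
        rw [abs_mul, mul_comm]
        exact mul_le_mul_of_nonneg_right (hv k) (abs_nonneg _)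
    _ = l * norm1 u := (Finset.mul_sum _ _ _).symm

theorem abs_dotProduct_mulVec_le (u : Fin p → ℝ) {E : Matrix (Fin p) (Fin p) ℝ} {τ : ℝ}
    (hE : ∀ s t, |E s t| ≤ τ) : |u ⬝ᵥ E *ᵥ u| ≤ τ * norm1 u ^ 2 := by
  have hrow (s : Fin p) : |(E *ᵥ u) s| ≤ τ * norm1 u := by
    rw [mulVec, dotProduct_comm]
    exact abs_dotProduct_le_mul_norm1 u (hE s)
  exact (abs_dotProduct_le_mul_norm1 u hrow).trans_eq (by ring)

theorem abs_dotProduct_plugOne_le (u : Fin p → ℝ) (j : Fin p) (x : Fin p → Bool) :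
    |u ⬝ᵥ plugOne j x| ≤ norm1 u := by
  simpa using abs_dotProduct_le_mul_norm1 u (abs_plugOne_le_one j x)

theorem dotProduct_plugOne (u : Fin p → ℝ) (j : Fin p) (x : Fin p → Bool) :
    u ⬝ᵥ plugOne j x = u j + ∑ k ∈ Finset.univ.erase j, u k * bit (x k) := by
  rw [dotProduct, ← Finset.add_sum_erase _ _ (Finset.mem_univ j)]
  congr 1
  · simp [plugOne]
  · exact Finset.sum_congr rfl fun k hk => by simp [plugOne, Finset.ne_of_mem_erase hk]

/-- The log-likelihood of the logistic regression of the `j`-th variable on the others, whose sum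
over `j` is the logarithm of the quasi-likelihood. -/
noncomputable def colLogLik {n : ℕ} (z : Fin n → Fin p → Bool) (j : Fin p) (u : Fin p → ℝ) : ℝ :=
  ∑ i, (bit (z i j) * (u ⬝ᵥ plugOne j (z i)) - Real.log (1 + Real.exp (u ⬝ᵥ plugOne j (z i))))

/-- The score of the `j`-th logistic regression at the parameter `a`, for one observation `x`. -/
noncomputable def score (a : Fin p → ℝ) (j : Fin p) (x : Fin p → Bool) : Fin p → ℝ :=
  (bit (x j) - Real.sigmoid (a ⬝ᵥ plugOne j x)) • plugOne j x

/-- The information matrix of the `j`-th logistic regression at the parameter `a`, for one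
observation `x`; its expectation under the Ising model is the matrix `fisher`. -/
noncomputable def infoMatrix (a : Fin p → ℝ) (j : Fin p) (x : Fin p → Bool) :
    Matrix (Fin p) (Fin p) ℝ :=
  logisticSecond (a ⬝ᵥ plugOne j x) • vecMulVec (plugOne j x) (plugOne j x)

theorem infoMatrix_apply_mem_Icc (a : Fin p → ℝ) (j : Fin p) (x : Fin p → Bool) (s t : Fin p) :
    infoMatrix a j x s t ∈ Set.Icc (0 : ℝ) (1 / 4) := by
  obtain ⟨hs₀, hs₁⟩ := plugOne_mem_Icc j x s
  obtain ⟨ht₀, ht₁⟩ := plugOne_mem_Icc j x t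
  have hg := logisticSecond_nonneg (a ⬝ᵥ plugOne j x)
  rw [infoMatrix, Matrix.smul_apply, vecMulVec_apply, smul_eq_mul]
  exact ⟨by positivity, (mul_le_of_le_one_right hg (mul_le_one₀ hs₁ ht₀ ht₁)).trans
    (logisticSecond_le _)⟩

theorem dotProduct_infoMatrix_mulVec (a u : Fin p → ℝ) (j : Fin p) (x : Fin p → Bool) :
    u ⬝ᵥ infoMatrix a j x *ᵥ u = logisticSecond (a ⬝ᵥ plugOne j x) * (u ⬝ᵥ plugOne j x) ^ 2 := by
  rw [infoMatrix, smul_mulVec, vecMulVec_mulVec, dotProduct_smul, dotProduct_smul,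
    dotProduct_comm (plugOne j x) u]
  simp only [MulOpposite.smul_eq_mul_unop, MulOpposite.unop_op, smul_eq_mul]
  ring

theorem dotProduct_sum_infoMatrix_mulVec_nonneg {n : ℕ} (z : Fin n → Fin p → Bool)
    (a u : Fin p → ℝ) (j : Fin p) : 0 ≤ u ⬝ᵥ (∑ i, infoMatrix a j (z i)) *ᵥ u := by
  rw [sum_mulVec, dotProduct_sum]
  refine Finset.sum_nonneg fun i _ => ?_
  rw [dotProduct_infoMatrix_mulVec]
  exact mul_nonneg (logisticSecond_nonneg _) (sq_nonneg _)

theorem isingDensity_nonneg (θ : Matrix (Fin p) (Fin p) ℝ) (x : Fin p → Bool) :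
    0 ≤ isingDensity θ x :=
  (div_pos (isingWeight_pos θ x) (isingConst_pos θ)).le

theorem sum_isingDensity (θ : Matrix (Fin p) (Fin p) ℝ) : ∑ x, isingDensity θ x = 1 := by
  simp_rw [isingDensity]
  rw [← Finset.sum_div]
  exact div_self (isingConst_pos θ).ne'

theorem fisher_eq_sum (θ : Matrix (Fin p) (Fin p) ℝ) (j : Fin p) :
    fisher θ j = ∑ x, isingDensity θ x • infoMatrix (column θ j) j x := by
  ext s t
  simp [fisher, infoMatrix, vecMulVec_apply, Matrix.sum_apply]

theorem fisher_apply_mem_Icc (θ : Matrix (Fin p) (Fin p) ℝ) (j s t : Fin p) :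
    fisher θ j s t ∈ Set.Icc (0 : ℝ) (1 / 4) := by
  have hinfo (x : Fin p → Bool) := infoMatrix_apply_mem_Icc (column θ j) j x s t
  rw [fisher_eq_sum, Matrix.sum_apply]
  refine ⟨Finset.sum_nonneg fun x _ => mul_nonneg (isingDensity_nonneg θ x) (hinfo x).1, ?_⟩
  calc ∑ x, isingDensity θ x * infoMatrix (column θ j) j x s t
      ≤ ∑ x, isingDensity θ x * (1 / 4) := Finset.sum_le_sum fun x _ =>
        mul_le_mul_of_nonneg_left (hinfo x).2 (isingDensity_nonneg θ x)
    _ = 1 / 4 := by rw [← Finset.sum_mul, sum_isingDensity, one_mul]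

theorem dotProduct_fisher_mulVec_nonneg (θ : Matrix (Fin p) (Fin p) ℝ) (j : Fin p)
    (u : Fin p → ℝ) : 0 ≤ u ⬝ᵥ fisher θ j *ᵥ u := by
  rw [fisher_eq_sum, sum_mulVec, dotProduct_sum]
  refine Finset.sum_nonneg fun x _ => ?_
  rw [smul_mulVec, dotProduct_smul, dotProduct_infoMatrix_mulVec]
  exact mul_nonneg (isingDensity_nonneg θ x) (mul_nonneg (logisticSecond_nonneg _) (sq_nonneg _))

variable {n : ℕ} (z : Fin n → Fin p → Bool) (j : Fin p)

theorem measurable_colLogLik : Measurable (colLogLik z j) := by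
  have hdot (v : Fin p → ℝ) : Measurable fun u : Fin p → ℝ => u ⬝ᵥ v :=
    Finset.measurable_sum _ fun k _ => (measurable_pi_apply k).mul_const _
  exact Finset.measurable_sum _ fun i _ => ((hdot _).const_mul _).sub ((hdot _).exp.const_add 1).log

theorem quasiLik_eq_prod_exp_colLogLik (θ : Matrix (Fin p) (Fin p) ℝ) :
    quasiLik z θ = ∏ j, Real.exp (colLogLik z j (column θ j)) := by
  refine Finset.prod_congr rfl fun j _ => ?_
  rw [colLogLik, Real.exp_sum]
  refine Finset.prod_congr rfl fun i _ => ?_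
  rw [Real.exp_sub, Real.exp_log (by positivity), dotProduct_plugOne]
  rfl

theorem colLogLik_add_sub (a u : Fin p → ℝ) :
    colLogLik z j (a + u) - colLogLik z j a = u ⬝ᵥ ∑ i, score a j (z i) -
      ∑ i, logisticBregman (a ⬝ᵥ plugOne j (z i)) (u ⬝ᵥ plugOne j (z i)) := by
  rw [colLogLik, colLogLik, dotProduct_sum, ← Finset.sum_sub_distrib, ← Finset.sum_sub_distrib]
  refine Finset.sum_congr rfl fun i _ => ?_
  rw [score, dotProduct_smul, smul_eq_mul, add_dotProduct, logisticBregman]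
  ring

variable {a : Fin p → ℝ} {l : ℝ}

theorem colLogLik_add_sub_le (hl : ∀ k, |(∑ i, score a j (z i)) k| ≤ l) (u : Fin p → ℝ) :
    colLogLik z j (a + u) - colLogLik z j a ≤
      l * norm1 u - (u ⬝ᵥ (∑ i, infoMatrix a j (z i)) *ᵥ u) / (2 * (1 + norm1 u)) := by
  have hscore := (abs_le.1 (abs_dotProduct_le_mul_norm1 u hl)).2
  have hbregman : (u ⬝ᵥ (∑ i, infoMatrix a j (z i)) *ᵥ u) / (2 * (1 + norm1 u)) ≤
      ∑ i, logisticBregman (a ⬝ᵥ plugOne j (z i)) (u ⬝ᵥ plugOne j (z i)) := by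
    rw [sum_mulVec, dotProduct_sum, Finset.sum_div]
    refine Finset.sum_le_sum fun i _ => le_trans ?_ (logisticSecond_mul_le_logisticBregman _ _)
    rw [dotProduct_infoMatrix_mulVec, mul_div_assoc]
    gcongr
    · exact logisticSecond_nonneg _
    · exact abs_dotProduct_plugOne_le u j (z i)
  rw [colLogLik_add_sub]
  linarith

theorem le_colLogLik_add_sub (hl : ∀ k, |(∑ i, score a j (z i)) k| ≤ l) (u : Fin p → ℝ) :
    -(l * norm1 u) - n * norm1 u ^ 2 / 8 ≤ colLogLik z j (a + u) - colLogLik z j a := by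
  have hscore := (abs_le.1 (abs_dotProduct_le_mul_norm1 u hl)).1
  have hbregman : ∑ i, logisticBregman (a ⬝ᵥ plugOne j (z i)) (u ⬝ᵥ plugOne j (z i)) ≤
      n * norm1 u ^ 2 / 8 := by
    calc _ ≤ ∑ _i : Fin n, norm1 u ^ 2 / 8 := Finset.sum_le_sum fun i _ =>
          (logisticBregman_le _ _).trans <| div_le_div_of_nonneg_right
            (sq_le_sq' (abs_le.1 (abs_dotProduct_plugOne_le u j (z i))).1
              (abs_le.1 (abs_dotProduct_plugOne_le u j (z i))).2) (by norm_num)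
      _ = n * norm1 u ^ 2 / 8 := by
        rw [Finset.sum_const, Finset.card_univ, Fintype.card_fin, nsmul_eq_mul, mul_div_assoc]
  rw [colLogLik_add_sub]
  linarith

end LogLikelihood

/-! ### The product structure of the quasi-posterior -/

section QuasiPosterior

variable {p n : ℕ}

theorem measurable_column (j : Fin p) :
    Measurable fun θ : Matrix (Fin p) (Fin p) ℝ => column θ j :=
  measurable_pi_lambda _ fun k =>
    (measurable_pi_apply j).comp (measurable_pi_apply (X := fun _ : Fin p => Fin p → ℝ) k)

theorem measurable_of_columns :
    Measurable fun c : Fin p → Fin p → ℝ => (Matrix.of fun k j => c j k : Matrix _ _ ℝ) :=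
  measurable_pi_lambda (X := fun _ : Fin p => Fin p → ℝ) _ fun k => measurable_pi_lambda _ fun j =>
    (measurable_pi_apply k).comp (measurable_pi_apply (X := fun _ : Fin p => Fin p → ℝ) j)

theorem measurable_quasiLik (z : Fin n → Fin p → Bool) : Measurable (quasiLik z) := by
  rw [funext (quasiLik_eq_prod_exp_colLogLik z)]
  exact Finset.measurable_prod _ fun j _ =>
    ((measurable_colLogLik z j).comp (measurable_column j)).exp

/-- The quasi-posterior before normalization. -/
noncomputable def unnormalizedPosterior (g : ℕ → ℝ) (ρ : ℝ) (z : Fin n → Fin p → Bool) :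
    Measure (Matrix (Fin p) (Fin p) ℝ) :=
  (matrixPrior p g ρ).withDensity fun θ => ENNReal.ofReal (quasiLik z θ)

theorem quasiPosterior_apply (g : ℕ → ℝ) (ρ : ℝ) (z : Fin n → Fin p → Bool)
    (A : Set (Matrix (Fin p) (Fin p) ℝ)) : quasiPosterior g ρ z A =
      (unnormalizedPosterior g ρ z Set.univ)⁻¹ * unnormalizedPosterior g ρ z A := rfl

theorem quasiPosterior_le_of_unnormalizedPosterior_le {g : ℕ → ℝ} {ρ : ℝ}
    {z : Fin n → Fin p → Bool} {A : Set (Matrix (Fin p) (Fin p) ℝ)} {ε : ENNReal}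
    (h : unnormalizedPosterior g ρ z A ≤ ε * unnormalizedPosterior g ρ z Set.univ) :
    quasiPosterior g ρ z A ≤ ε := by
  rw [quasiPosterior_apply]
  calc (unnormalizedPosterior g ρ z Set.univ)⁻¹ * unnormalizedPosterior g ρ z A
      ≤ (unnormalizedPosterior g ρ z Set.univ)⁻¹ * (ε * unnormalizedPosterior g ρ z Set.univ) := by
        gcongr
    _ = ε * ((unnormalizedPosterior g ρ z Set.univ)⁻¹ *
          unnormalizedPosterior g ρ z Set.univ) := by ring
    _ ≤ ε := mul_le_of_le_one_right' (ENNReal.inv_mul_le_one _)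

theorem quasiPosterior_le_one (g : ℕ → ℝ) (ρ : ℝ) (z : Fin n → Fin p → Bool)
    (A : Set (Matrix (Fin p) (Fin p) ℝ)) : quasiPosterior g ρ z A ≤ 1 :=
  quasiPosterior_le_of_unnormalizedPosterior_le
    ((measure_mono (Set.subset_univ A)).trans_eq (one_mul _).symm)

theorem unnormalizedPosterior_forall_column_mem (g : ℕ → ℝ) (ρ : ℝ) (z : Fin n → Fin p → Bool)
    {B : Fin p → Set (Fin p → ℝ)} (hB : ∀ j, MeasurableSet (B j)) :
    unnormalizedPosterior g ρ z {θ | ∀ j, column θ j ∈ B j} =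
      ∏ j, ∫⁻ u in B j, ENNReal.ofReal (Real.exp (colLogLik z j u)) ∂(columnPrior p g ρ) := by
  have hset : MeasurableSet {θ : Matrix (Fin p) (Fin p) ℝ | ∀ j, column θ j ∈ B j} :=
    Set.ofPred_forall _ ▸ MeasurableSet.iInter fun j => measurable_column j (hB j)
  have hpre : (fun c : Fin p → Fin p → ℝ => (Matrix.of fun k j => c j k : Matrix _ _ ℝ)) ⁻¹'
      {θ | ∀ j, column θ j ∈ B j} = Set.univ.pi B := by
    ext c
    exact ⟨fun h j _ => h j, fun h j => h j (Set.mem_univ j)⟩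
  have hlik (c : Fin p → Fin p → ℝ) : ENNReal.ofReal (quasiLik z (Matrix.of fun k j => c j k)) =
      ∏ j, ENNReal.ofReal (Real.exp (colLogLik z j (c j))) := by
    rw [quasiLik_eq_prod_exp_colLogLik, ENNReal.ofReal_prod_of_nonneg fun _ _ => Real.exp_nonneg _]
    rfl
  rw [unnormalizedPosterior, withDensity_apply _ hset, matrixPrior,
    setLIntegral_map hset (measurable_quasiLik z).ennreal_ofReal measurable_of_columns, hpre,
    Measure.restrict_pi_pi]
  simp_rw [hlik]
  exact lintegral_pi_prod_eq_prod (f := fun j u => ENNReal.ofReal (Real.exp (colLogLik z j u)))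
    fun j => (measurable_colLogLik z j).exp.ennreal_ofReal

theorem quasiPosterior_column_mem_le {g : ℕ → ℝ} {ρ : ℝ} {z : Fin n → Fin p → Bool} {j : Fin p}
    {A : Set (Fin p → ℝ)} (hA : MeasurableSet A) {ε : ENNReal}
    (h : ∫⁻ u in A, ENNReal.ofReal (Real.exp (colLogLik z j u)) ∂(columnPrior p g ρ) ≤
      ε * ∫⁻ u, ENNReal.ofReal (Real.exp (colLogLik z j u)) ∂(columnPrior p g ρ)) :
    quasiPosterior g ρ z {θ | column θ j ∈ A} ≤ ε := by
  classical
  set I : Fin p → Set (Fin p → ℝ) → ENNReal := fun i B =>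
    ∫⁻ u in B, ENNReal.ofReal (Real.exp (colLogLik z i u)) ∂(columnPrior p g ρ)
  let B : Fin p → Set (Fin p → ℝ) := Function.update (fun _ => Set.univ) j A
  have hB (i : Fin p) : MeasurableSet (B i) := by
    rcases eq_or_ne i j with rfl | hi
    · simpa [B] using hA
    · simp [B, hi]
  have hset : {θ : Matrix (Fin p) (Fin p) ℝ | column θ j ∈ A} = {θ | ∀ i, column θ i ∈ B i} := by
    ext θ
    simp [B, Function.update_apply]
  have huniv : unnormalizedPosterior g ρ z Set.univ = ∏ i, I i Set.univ := by
    simpa [I] using unnormalizedPosterior_forall_column_mem g ρ z (B := fun _ => Set.univ)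
      fun _ => MeasurableSet.univ
  refine quasiPosterior_le_of_unnormalizedPosterior_le ?_
  rw [hset, unnormalizedPosterior_forall_column_mem g ρ z hB, huniv]
  calc ∏ i, I i (B i) = I j A * ∏ i ∈ Finset.univ.erase j, I i Set.univ := by
        rw [← Finset.mul_prod_erase _ _ (Finset.mem_univ j)]
        congr 1
        · simp [B]
        · exact Finset.prod_congr rfl fun i hi => by simp [B, Finset.ne_of_mem_erase hi]
    _ ≤ ε * I j Set.univ * ∏ i ∈ Finset.univ.erase j, I i Set.univ := by
        gcongr
        simpa [I] using h
    _ = ε * ∏ i, I i Set.univ := by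
        rw [mul_assoc, Finset.mul_prod_erase _ (fun i => I i Set.univ) (Finset.mem_univ j)]

end QuasiPosterior

/-! ### The score under the Ising model -/

section IsingScore

open Matrix

theorem two_mul_sum_sum_lt_of_isSymm {ι : Type*} [Fintype ι] [LinearOrder ι] {θ : Matrix ι ι ℝ}
    (hθ : θ.IsSymm) (y : ι → ℝ) :
    2 * ∑ i, ∑ j, (if i < j then θ i j * y i * y j else 0) =
      y ⬝ᵥ θ *ᵥ y - ∑ k, θ k k * y k ^ 2 := by
  have hswap : ∑ i, ∑ j, (if i < j then θ i j * y i * y j else 0) =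
      ∑ i, ∑ j, (if j < i then θ i j * y i * y j else 0) := by
    rw [Finset.sum_comm]
    refine Finset.sum_congr rfl fun i _ => Finset.sum_congr rfl fun j _ => ?_
    rw [hθ.apply i j, mul_right_comm]
  have hdiag : ∑ k, θ k k * y k ^ 2 = ∑ i, ∑ j, if i = j then θ i j * y i * y j else 0 := by
    simp [pow_two, mul_assoc]
  have hquad : y ⬝ᵥ θ *ᵥ y = ∑ i, ∑ j, θ i j * y i * y j := by
    simp only [dotProduct, mulVec, Finset.mul_sum]
    exact Finset.sum_congr rfl fun i _ => Finset.sum_congr rfl fun j _ => by ring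
  rw [two_mul]
  nth_rw 2 [hswap]
  rw [hdiag, hquad, ← Finset.sum_add_distrib, ← Finset.sum_sub_distrib]
  refine Finset.sum_congr rfl fun i _ => ?_
  rw [← Finset.sum_add_distrib, ← Finset.sum_sub_distrib]
  refine Finset.sum_congr rfl fun j _ => ?_
  rcases lt_trichotomy i j with h | rfl | h
  · simp [h, h.not_gt, h.ne]
  · simp
  · simp [h, h.not_gt, h.ne']

variable {p : ℕ} {θ : Matrix (Fin p) (Fin p) ℝ}

theorem isingWeight_eq_exp_quadForm (hθ : θ.IsSymm) (x : Fin p → Bool) {y : Fin p → ℝ}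
    (hy : ∀ k, y k = bit (x k)) :
    isingWeight θ x = Real.exp ((y ⬝ᵥ θ *ᵥ y + ∑ k, θ k k * y k) / 2) := by
  have hsq (k : Fin p) : y k ^ 2 = y k := by
    rw [hy]
    cases x k <;> simp [bit]
  have hpairs := two_mul_sum_sum_lt_of_isSymm hθ y
  simp only [hsq] at hpairs
  simp only [isingWeight, ← hy]
  congr 1
  linarith

theorem isingWeight_update_true (hθ : θ.IsSymm) (j : Fin p) (x : Fin p → Bool) :
    isingWeight θ (Function.update x j true) =
      isingWeight θ (Function.update x j false) * Real.exp (column θ j ⬝ᵥ plugOne j x) := by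
  obtain ⟨F, hF⟩ : ∃ F : Fin p → ℝ, plugOne j x = F + Pi.single j 1 :=
    ⟨plugOne j x - Pi.single j 1, by simp⟩
  have htrue (k : Fin p) :
      (F + Pi.single j 1 : Fin p → ℝ) k = bit (Function.update x j true k) := by
    rw [← hF]
    rcases eq_or_ne k j with rfl | hk
    · simp [plugOne, bit]
    · simp [plugOne, hk]
  have hfalse (k : Fin p) : F k = bit (Function.update x j false k) := by
    rw [← add_sub_cancel_right F (Pi.single j 1), ← hF]
    rcases eq_or_ne k j with rfl | hk
    · simp [plugOne, bit]
    · simp [plugOne, hk]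
  have hcol : F ⬝ᵥ θ.col j = column θ j ⬝ᵥ F := dotProduct_comm _ _
  have hrow : (θ *ᵥ F) j = column θ j ⬝ᵥ F :=
    congrArg (· ⬝ᵥ F) (funext fun k => hθ.apply k j)
  rw [isingWeight_eq_exp_quadForm hθ _ htrue, isingWeight_eq_exp_quadForm hθ _ hfalse,
    ← Real.exp_add, hF]
  congr 1
  simp only [Pi.add_apply, mul_add, Finset.sum_add_distrib, mulVec_add, add_dotProduct,
    dotProduct_add, mulVec_single_one, single_one_dotProduct, dotProduct_single_one,
    Pi.single_apply, mul_ite, mul_one, mul_zero, Finset.sum_ite_eq', Finset.mem_univ, if_true,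
    hcol, hrow, column, col_apply]
  ring

theorem plugOne_update (j : Fin p) (x : Fin p → Bool) (b : Bool) :
    plugOne j (Function.update x j b) = plugOne j x := by
  ext k
  rcases eq_or_ne k j with rfl | hk <;> simp [plugOne, *]

theorem isingDensity_smul_score_update_add (hθ : θ.IsSymm) (j : Fin p) (x : Fin p → Bool) :
    isingDensity θ (Function.update x j true) •
        score (column θ j) j (Function.update x j true) +
      isingDensity θ (Function.update x j false) •
        score (column θ j) j (Function.update x j false) = 0 := by
  have hconst := (isingConst_pos θ).ne'
  rw [score, score, plugOne_update, plugOne_update, smul_smul, smul_smul, ← add_smul]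
  refine smul_eq_zero_of_left ?_ _
  simp only [isingDensity, isingWeight_update_true hθ, Function.update_self, bit, if_true,
    Bool.false_eq_true, if_false, sigmoid_eq_exp_div]
  field_simp
  ring

theorem sum_isingDensity_smul_score (hθ : θ.IsSymm) (j : Fin p) :
    ∑ x, isingDensity θ x • score (column θ j) j x = 0 := by
  refine Finset.sum_involution (fun x _ => Function.update x j (!x j)) (fun x _ => ?_)
    (fun x _ _ h => ?_) (fun x _ => Finset.mem_univ _) (fun x _ => by simp)
  · have hpair := isingDensity_smul_score_update_add hθ j x
    have hself := Function.update_eq_self j x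
    cases hx : x j
    · rw [hx] at hself
      rwa [hself, add_comm] at hpair
    · rw [hx] at hself
      rwa [hself] at hpair
  · simpa using congrFun h j

end IsingScore

/-! ### Concentration of the scores and of the information matrices -/

section Concentration

open Matrix

theorem pi_const_sum_ge_le {Ω : Type*} [MeasurableSpace Ω] (μ : Measure Ω)
    [IsProbabilityMeasure μ] {f : Ω → ℝ} (hf : Measurable f) (hbound : ∀ x, |f x| ≤ 1)
    (hmean : ∫ x, f x ∂μ = 0) (n : ℕ) {t : ℝ} (ht : 0 ≤ t) :
    Measure.pi (fun _ : Fin n => μ) {z | t ≤ ∑ i, f (z i)} ≤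
      ENNReal.ofReal (Real.exp (-t ^ 2 / (2 * n))) := by
  have hsub : ProbabilityTheory.HasSubgaussianMGF f 1 μ := by
    have h := ProbabilityTheory.hasSubgaussianMGF_of_mem_Icc_of_integral_eq_zero (a := -1) (b := 1)
      hf.aemeasurable (Filter.Eventually.of_forall fun x => abs_le.1 (hbound x)) hmean
    have hvariance : (‖(1 : ℝ) - -1‖₊ / 2) ^ 2 = 1 := NNReal.coe_injective (by norm_num)
    rwa [hvariance] at h
  have hcoord (i : Fin n) : ProbabilityTheory.HasSubgaussianMGF (fun z => f (z i)) 1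
      (Measure.pi fun _ : Fin n => μ) := by
    refine .of_map (Y := fun z : Fin n → Ω => z i) (measurable_pi_apply i).aemeasurable ?_
    rwa [(measurePreserving_eval (fun _ : Fin n => μ) i).map_eq]
  have hindep := ProbabilityTheory.iIndepFun_pi (μ := fun _ : Fin n => μ) (X := fun _ => f)
    fun _ => hf.aemeasurable
  rw [← ofReal_measureReal]
  refine ENNReal.ofReal_le_ofReal
    ((ProbabilityTheory.HasSubgaussianMGF.measure_sum_ge_le_of_iIndepFun hindep
      (s := Finset.univ) (fun i _ => hcoord i) ht).trans_eq ?_)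
  simp

theorem pi_const_abs_sum_gt_le {Ω : Type*} [MeasurableSpace Ω] (μ : Measure Ω)
    [IsProbabilityMeasure μ] {f : Ω → ℝ} (hf : Measurable f) (hbound : ∀ x, |f x| ≤ 1)
    (hmean : ∫ x, f x ∂μ = 0) (n : ℕ) {t : ℝ} (ht : 0 ≤ t) :
    Measure.pi (fun _ : Fin n => μ) {z | t < |∑ i, f (z i)|} ≤
      2 * ENNReal.ofReal (Real.exp (-t ^ 2 / (2 * n))) := by
  have hupper := pi_const_sum_ge_le μ hf hbound hmean n ht
  have hlower := pi_const_sum_ge_le μ (f := fun x => -f x) hf.neg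
    (by simpa only [abs_neg] using hbound) (by rw [integral_neg, hmean, neg_zero]) n ht
  rw [two_mul]
  refine (measure_mono fun z hz => ?_).trans
    ((measure_union_le _ _).trans (add_le_add hupper hlower))
  rcases lt_abs.1 (Set.mem_ofPred_eq ▸ hz) with h | h
  · exact Or.inl h.le
  · exact Or.inr (by simpa only [Set.mem_ofPred_eq, Finset.sum_neg_distrib] using h.le)

theorem measure_iUnion_le_card_mul {Ω ι : Type*} [MeasurableSpace Ω] [Fintype ι] (μ : Measure Ω)
    {S : ι → Set Ω} {ε : ENNReal} (hS : ∀ i, μ (S i) ≤ ε) :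
    μ (⋃ i, S i) ≤ Fintype.card ι * ε := by
  refine (measure_iUnion_fintype_le μ S).trans ((Finset.sum_le_sum fun i _ => hS i).trans_eq ?_)
  rw [Finset.sum_const, Finset.card_univ, nsmul_eq_mul]

variable {p n : ℕ}

instance isProbabilityMeasure_dataLaw (θ : Matrix (Fin p) (Fin p) ℝ) :
    IsProbabilityMeasure (dataLaw n θ) := by
  rw [dataLaw]
  infer_instance

theorem integral_isingPMF (θ : Matrix (Fin p) (Fin p) ℝ) (f : (Fin p → Bool) → ℝ) :
    ∫ x, f x ∂(isingPMF θ).toMeasure = ∑ x, isingDensity θ x * f x := by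
  rw [PMF.integral_eq_sum]
  refine Finset.sum_congr rfl fun x _ => ?_
  rw [smul_eq_mul, isingPMF, PMF.ofFintype_apply, ENNReal.toReal_ofReal (isingDensity_nonneg θ x)]

theorem dataLaw_abs_sum_gt_le {θ : Matrix (Fin p) (Fin p) ℝ} {f : (Fin p → Bool) → ℝ}
    (hbound : ∀ x, |f x| ≤ 1) (hmean : ∑ x, isingDensity θ x * f x = 0) (hp : 1 ≤ p)
    {t : ℝ} (ht : 0 ≤ t) (hn : 1 ≤ n) (hlarge : 8 * n * Real.log p ≤ t ^ 2) :
    dataLaw n θ {z | t < |∑ i, f (z i)|} ≤ ENNReal.ofReal (2 / p ^ 4) := by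
  have hp₀ : (0 : ℝ) < p := by exact_mod_cast hp
  have hexp : 2 * Real.exp (-t ^ 2 / (2 * n)) ≤ 2 / p ^ 4 := by
    have hpow : ((p : ℝ) ^ 4)⁻¹ = Real.exp (-(4 * Real.log p)) := by
      rw [Real.exp_neg, mul_comm, Real.exp_mul, Real.exp_log hp₀]
      norm_cast
    rw [div_eq_mul_inv 2, hpow]
    gcongr
    rw [div_le_iff₀ (by positivity)]
    linarith
  refine (pi_const_abs_sum_gt_le _ (measurable_of_countable f) hbound
    ((integral_isingPMF θ f).trans hmean) n ht).trans ?_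
  rw [← ENNReal.ofReal_ofNat, ← ENNReal.ofReal_mul zero_le_two]
  exact ENNReal.ofReal_le_ofReal hexp

/-- The event that all scores at the true parameter are bounded by `l` and that the empirical
information matrices are within `τ` of their expectations entrywise. On this event the
quasi-likelihood has the curvature of the matrices `fisher`. -/
def Regular (θ : Matrix (Fin p) (Fin p) ℝ) (l τ : ℝ) (z : Fin n → Fin p → Bool) : Prop :=
  (∀ j k, |(∑ i, score (column θ j) j (z i)) k| ≤ l) ∧
    ∀ j s t, |(∑ i, (infoMatrix (column θ j) j (z i) - fisher θ j)) s t| ≤ n * τ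

theorem Regular.mul_dotProduct_fisher_mulVec_le {θ : Matrix (Fin p) (Fin p) ℝ} {l τ : ℝ}
    {z : Fin n → Fin p → Bool} (hz : Regular θ l τ z) (j : Fin p) (u : Fin p → ℝ) :
    n * (u ⬝ᵥ fisher θ j *ᵥ u) ≤
      u ⬝ᵥ (∑ i, infoMatrix (column θ j) j (z i)) *ᵥ u + n * τ * norm1 u ^ 2 := by
  have hdiff := (abs_le.1 (abs_dotProduct_mulVec_le u (hz.2 j))).1
  simp only [Finset.sum_sub_distrib, Finset.sum_const, Finset.card_univ, Fintype.card_fin,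
    sub_mulVec, dotProduct_sub, smul_mulVec, dotProduct_smul] at hdiff
  rw [nsmul_eq_mul] at hdiff
  linarith

theorem abs_score_apply_le_one (a : Fin p → ℝ) (j : Fin p) (x : Fin p → Bool) (k : Fin p) :
    |score a j x k| ≤ 1 := by
  obtain ⟨hb₀, hb₁⟩ := bit_mem_Icc (x j)
  have hσ₀ := Real.sigmoid_nonneg (a ⬝ᵥ plugOne j x)
  have hσ₁ := Real.sigmoid_le_one (a ⬝ᵥ plugOne j x)
  rw [score, Pi.smul_apply, smul_eq_mul, abs_mul]
  exact mul_le_one₀ (abs_le.2 ⟨by linarith, by linarith⟩) (abs_nonneg _) (abs_plugOne_le_one j x k)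

theorem dataLaw_abs_sum_score_gt_le {θ : Matrix (Fin p) (Fin p) ℝ} (hθ : θ.IsSymm) (hn : 1 ≤ n)
    {l : ℝ} (hl : 0 ≤ l) (hlarge : 8 * n * Real.log p ≤ l ^ 2) (j k : Fin p) :
    dataLaw n θ {z | l < |(∑ i, score (column θ j) j (z i)) k|} ≤ ENNReal.ofReal (2 / p ^ 4) := by
  have hmean := congrFun (sum_isingDensity_smul_score hθ j) k
  simp only [Finset.sum_apply, Pi.smul_apply, smul_eq_mul, Pi.zero_apply] at hmean ⊢
  exact dataLaw_abs_sum_gt_le (fun x => abs_score_apply_le_one _ j x k) hmean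
    (Nat.one_le_of_lt j.isLt) hl hn hlarge

theorem dataLaw_abs_sum_infoMatrix_sub_fisher_gt_le (θ : Matrix (Fin p) (Fin p) ℝ) (hn : 1 ≤ n)
    {τ : ℝ} (hτ : 0 ≤ τ) (hlarge : 8 * Real.log p ≤ n * τ ^ 2) (j s t : Fin p) :
    dataLaw n θ {z | n * τ < |(∑ i, (infoMatrix (column θ j) j (z i) - fisher θ j)) s t|} ≤
      ENNReal.ofReal (2 / p ^ 4) := by
  obtain ⟨hF₀, hF₁⟩ := fisher_apply_mem_Icc θ j s t
  simp only [Matrix.sum_apply, Matrix.sub_apply]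
  refine dataLaw_abs_sum_gt_le (f := fun x => infoMatrix (column θ j) j x s t - fisher θ j s t)
    (fun x => ?_) ?_ (Nat.one_le_of_lt j.isLt) (by positivity) hn ?_
  · obtain ⟨h₀, h₁⟩ := infoMatrix_apply_mem_Icc (column θ j) j x s t
    exact abs_le.2 ⟨by linarith, by linarith⟩
  · simp only [mul_sub, Finset.sum_sub_distrib, ← Finset.sum_mul, sum_isingDensity, fisher_eq_sum,
      Matrix.sum_apply, Matrix.smul_apply, smul_eq_mul, one_mul, sub_self]
  · calc 8 * n * Real.log p = n * (8 * Real.log p) := by ring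
      _ ≤ n * (n * τ ^ 2) := by gcongr
      _ = (n * τ) ^ 2 := by ring

theorem dataLaw_not_regular_le {θ : Matrix (Fin p) (Fin p) ℝ} (hθ : θ.IsSymm) (hp : 1 ≤ p)
    (hn : 1 ≤ n) {l τ : ℝ} (hl : 0 ≤ l) (hτ : 0 ≤ τ) (hl_large : 8 * n * Real.log p ≤ l ^ 2)
    (hτ_large : 8 * Real.log p ≤ n * τ ^ 2) :
    dataLaw n θ {z | ¬ Regular θ l τ z} ≤ ENNReal.ofReal (4 / p) := by
  have hsub : {z : Fin n → Fin p → Bool | ¬ Regular θ l τ z} ⊆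
      (⋃ q : Fin p × Fin p, {z | l < |(∑ i, score (column θ q.1) q.1 (z i)) q.2|}) ∪
      ⋃ q : Fin p × Fin p × Fin p, {z | n * τ <
        |(∑ i, (infoMatrix (column θ q.1) q.1 (z i) - fisher θ q.1)) q.2.1 q.2.2|} := by
    intro z hz
    by_contra hcon
    simp only [Set.mem_union, Set.mem_iUnion, Set.mem_ofPred_eq, not_or, not_exists, not_lt,
      Prod.forall] at hcon
    exact hz hcon
  have hscore := measure_iUnion_le_card_mul (dataLaw n θ) fun q : Fin p × Fin p =>
    dataLaw_abs_sum_score_gt_le hθ hn hl hl_large q.1 q.2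
  have hinfo := measure_iUnion_le_card_mul (dataLaw n θ) fun q : Fin p × Fin p × Fin p =>
    dataLaw_abs_sum_infoMatrix_sub_fisher_gt_le θ hn hτ hτ_large q.1 q.2.1 q.2.2
  refine (measure_mono hsub).trans ((measure_union_le _ _).trans
    ((add_le_add hscore hinfo).trans ?_))
  have hp₁ : (1 : ℝ) ≤ p := by exact_mod_cast hp
  have hbound :
      ((p * p : ℕ) : ℝ) * (2 / p ^ 4) + ((p * (p * p) : ℕ) : ℝ) * (2 / p ^ 4) ≤ 4 / p := by
    have hp₂ : 2 / (p : ℝ) ^ 2 ≤ 2 / p :=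
      div_le_div_of_nonneg_left zero_le_two (by positivity) (le_self_pow₀ hp₁ two_ne_zero)
    calc _ = 2 / (p : ℝ) ^ 2 + 2 / p := by
          push_cast
          field_simp
      _ ≤ 4 / p := by
          rw [show (4 : ℝ) / p = 2 / p + 2 / p by ring]
          gcongr
  refine le_trans (le_of_eq ?_) (ENNReal.ofReal_le_ofReal hbound)
  rw [ENNReal.ofReal_add (by positivity) (by positivity), ENNReal.ofReal_mul (Nat.cast_nonneg _),
    ENNReal.ofReal_mul (Nat.cast_nonneg _), ENNReal.ofReal_natCast, ENNReal.ofReal_natCast,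
    Fintype.card_prod, Fintype.card_prod, Fintype.card_prod, Fintype.card_fin]

end Concentration

/-! ### The sparsity prior -/

section SparsityPrior

variable {p : ℕ} {c₁ c₂ c₃ c₄ : ℝ} {g : ℕ → ℝ}

theorem SparsityPrior.pow_mul_le (h : SparsityPrior p c₁ c₂ c₃ c₄ g) (hc₁ : 0 ≤ c₁) {m : ℕ}
    (hm : m ≤ p) : (c₁ / (p : ℝ) ^ c₃) ^ m * g 0 ≤ g m := by
  induction m with
  | zero => simp
  | succ m ih =>
    calc (c₁ / (p : ℝ) ^ c₃) ^ (m + 1) * g 0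
        = c₁ / (p : ℝ) ^ c₃ * ((c₁ / (p : ℝ) ^ c₃) ^ m * g 0) := by ring
      _ ≤ c₁ / (p : ℝ) ^ c₃ * g m := mul_le_mul_of_nonneg_left (ih (by lia)) (by positivity)
      _ ≤ g (m + 1) := h.lower (m + 1) (by lia) hm

theorem SparsityPrior.le_pow_mul (h : SparsityPrior p c₁ c₂ c₃ c₄ g) (hc₂ : 0 ≤ c₂) {m : ℕ}
    (hm : m ≤ p) : g m ≤ (c₂ / (p : ℝ) ^ c₄) ^ m * g 0 := by
  induction m with
  | zero => simp
  | succ m ih =>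
    calc g (m + 1) ≤ c₂ / (p : ℝ) ^ c₄ * g m := h.upper (m + 1) (by lia) hm
      _ ≤ c₂ / (p : ℝ) ^ c₄ * ((c₂ / (p : ℝ) ^ c₄) ^ m * g 0) :=
        mul_le_mul_of_nonneg_left (ih (by lia)) (by positivity)
      _ = (c₂ / (p : ℝ) ^ c₄) ^ (m + 1) * g 0 := by ring

theorem SparsityPrior.sum_mul_four_pow_le (h : SparsityPrior p c₁ c₂ c₃ c₄ g) (hc₂ : 0 ≤ c₂)
    (hp : 1 ≤ p) (hpc₂ : 8 * c₂ ≤ (p : ℝ) ^ c₄) :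
    ∑ m ∈ Finset.range (p + 1), g m * 4 ^ m ≤ 2 * g 0 := by
  have hratio : c₂ / (p : ℝ) ^ c₄ * 4 ≤ 1 / 2 := by
    rw [div_mul_eq_mul_div, div_le_iff₀ (Real.rpow_pos_of_pos (by exact_mod_cast hp) _)]
    linarith
  have hg₀ := h.nonneg 0 p.zero_le
  calc ∑ m ∈ Finset.range (p + 1), g m * 4 ^ m
      ≤ ∑ m ∈ Finset.range (p + 1), (c₂ / (p : ℝ) ^ c₄ * 4) ^ m * g 0 := by
        refine Finset.sum_le_sum fun m hm => ?_
        rw [mul_pow, mul_right_comm]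
        exact mul_le_mul_of_nonneg_right (h.le_pow_mul hc₂ (Finset.mem_range_succ_iff.1 hm))
          (by positivity)
    _ ≤ ∑ m ∈ Finset.range (p + 1), (1 / 2 : ℝ) ^ m * g 0 := by gcongr
    _ ≤ 2 * g 0 := by
        rw [← Finset.sum_mul]
        exact mul_le_mul_of_nonneg_right (sum_geometric_two_le _) hg₀

theorem SparsityPrior.exp_neg_mul_le_div_choose (h : SparsityPrior p c₁ c₂ c₃ c₄ g)
    (hc₁ : 0 < c₁) (hp : 1 ≤ p) (hpc₁ : 1 / c₁ ≤ p) {s : ℕ} (hs : s ≤ p) :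
    Real.exp (-(s * ((c₃ + 2) * Real.log p))) * g 0 ≤ g s / (p.choose s : ℝ) := by
  have hp₀ : (0 : ℝ) < p := by exact_mod_cast hp
  have hchoose : (p.choose s : ℝ) ≤ (p : ℝ) ^ s := by exact_mod_cast Nat.choose_le_pow p s
  have hratio : Real.exp (-((c₃ + 2) * Real.log p)) * p ≤ c₁ / (p : ℝ) ^ c₃ := by
    rw [le_div_iff₀ (Real.rpow_pos_of_pos hp₀ _), Real.rpow_def_of_pos hp₀]
    calc Real.exp (-((c₃ + 2) * Real.log p)) * p * Real.exp (Real.log p * c₃)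
        = Real.exp (-((c₃ + 2) * Real.log p)) * Real.exp (Real.log p) *
            Real.exp (Real.log p * c₃) := by rw [Real.exp_log hp₀]
      _ = Real.exp (-Real.log p) := by
          rw [← Real.exp_add, ← Real.exp_add]
          ring_nf
      _ = (p : ℝ)⁻¹ := by rw [Real.exp_neg, Real.exp_log hp₀]
      _ ≤ c₁ := by rwa [inv_le_comm₀ hp₀ hc₁, ← one_div]
  rw [le_div_iff₀ (by exact_mod_cast Nat.choose_pos hs), ← mul_neg, Real.exp_nat_mul]
  have hg₀ := h.nonneg 0 p.zero_le
  calc Real.exp (-((c₃ + 2) * Real.log p)) ^ s * g 0 * p.choose s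
      ≤ Real.exp (-((c₃ + 2) * Real.log p)) ^ s * g 0 * (p : ℝ) ^ s := by gcongr
    _ = (Real.exp (-((c₃ + 2) * Real.log p)) * p) ^ s * g 0 := by ring
    _ ≤ (c₁ / (p : ℝ) ^ c₃) ^ s * g 0 := by gcongr
    _ ≤ g s := h.pow_mul_le hc₁.le hs

theorem SparsityPrior.exp_neg_mul_sum_le (h : SparsityPrior p c₁ c₂ c₃ c₄ g) (hc₁ : 0 < c₁)
    (hc₂ : 0 ≤ c₂) (hp : 2 ≤ p) (hpc₁ : 1 / c₁ ≤ p) (hpc₂ : 8 * c₂ ≤ (p : ℝ) ^ c₄) {s : ℕ}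
    (hs : s ≤ p) {b T : ℝ} (hT : 3 * Real.log p + s * ((c₃ + 2) * Real.log p) + b + s ≤ T) :
    Real.exp (-T) * ∑ m ∈ Finset.range (p + 1), g m * 4 ^ m ≤
      ((p : ℝ) ^ 2)⁻¹ * (Real.exp (-b - s) * (g s / (p.choose s : ℝ))) := by
  have hp₂ : (2 : ℝ) ≤ p := by exact_mod_cast hp
  have hp₀ : (0 : ℝ) < p := by linarith
  have hg₀ := h.nonneg 0 p.zero_le
  have hcube : Real.exp (-(3 * Real.log p)) * p = ((p : ℝ) ^ 2)⁻¹ := by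
    rw [Real.exp_neg, ← Nat.cast_ofNat, Real.exp_nat_mul, Real.exp_log hp₀]
    field_simp
  calc Real.exp (-T) * ∑ m ∈ Finset.range (p + 1), g m * 4 ^ m
      ≤ Real.exp (-T) * (2 * g 0) :=
        mul_le_mul_of_nonneg_left (h.sum_mul_four_pow_le hc₂ (by lia) hpc₂) (Real.exp_pos _).le
    _ ≤ Real.exp (-(3 * Real.log p) + (-b - s) + -(s * ((c₃ + 2) * Real.log p))) * (p * g 0) := by
        gcongr
        linarith
    _ = Real.exp (-(3 * Real.log p)) * p * (Real.exp (-b - s) *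
          (Real.exp (-(s * ((c₃ + 2) * Real.log p))) * g 0)) := by
        rw [Real.exp_add, Real.exp_add]
        ring
    _ ≤ ((p : ℝ) ^ 2)⁻¹ * (Real.exp (-b - s) * (g s / (p.choose s : ℝ))) := by
        rw [hcube]
        gcongr
        exact h.exp_neg_mul_le_div_choose hc₁ (by lia) hpc₁ hs

end SparsityPrior

/-! ### Restricted eigenvalues and sparsity levels -/

section RestrictedEigenvalues

open Matrix

variable {p : ℕ} {θ : Matrix (Fin p) (Fin p) ℝ} {j : Fin p}

theorem toReal_mul_norm2_sq_le_of_le_rayleigh {u : Fin p → ℝ} {κ : ENNReal}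
    (h : κ ≤ rayleigh θ j u) : κ.toReal * norm2 u ^ 2 ≤ u ⬝ᵥ fisher θ j *ᵥ u := by
  rcases eq_or_ne u 0 with rfl | hu
  · simp [norm2_sq]
  · rw [← le_div_iff₀ (norm2_sq_pos hu)]
    exact ENNReal.toReal_le_of_le_ofReal
      (div_nonneg (dotProduct_fisher_mulVec_nonneg θ j u) (sq_nonneg _)) h

theorem rayleigh_single_one (θ : Matrix (Fin p) (Fin p) ℝ) (j k : Fin p) :
    rayleigh θ j (Pi.single k 1) = ENNReal.ofReal (fisher θ j k k) := by
  rw [rayleigh, norm2_single_one_sq, dotProduct_mulVec_single, one_pow, mul_one, div_one]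

theorem kappaSparse_le_rayleigh {s : ℕ} {u : Fin p → ℝ} (hu : u ≠ 0) (hs : nnz u ≤ s) :
    kappaSparse θ s ≤ rayleigh θ j u :=
  iInf_le_of_le j (iInf₂_le_of_le u ⟨hu, hs⟩ le_rfl)

theorem toReal_kappaSparse_mul_norm2_sq_le {s : ℕ} {u : Fin p → ℝ} (hs : nnz u ≤ s) :
    (kappaSparse θ s).toReal * norm2 u ^ 2 ≤ u ⬝ᵥ fisher θ j *ᵥ u := by
  rcases eq_or_ne u 0 with rfl | hu
  · simp [norm2_sq]
  · exact toReal_mul_norm2_sq_le_of_le_rayleigh (kappaSparse_le_rayleigh hu hs)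

theorem kappaCone_le_rayleigh {u : Fin p → ℝ} (hu : u ≠ 0)
    (hcone : normOn (supp (column θ j))ᶜ u ≤ 7 * normOn (supp (column θ j)) u) :
    kappaCone θ ≤ rayleigh θ j u := by
  have hcompl : (supp (column θ j))ᶜ = Finset.univ.filter fun k => θ k j = 0 := by
    ext k
    simp [mem_supp, column]
  rw [hcompl] at hcone
  exact iInf_le_of_le j (iInf₂_le_of_le u ⟨hu, hcone⟩ le_rfl)

theorem kappaSparse_le_ofReal (θ : Matrix (Fin p) (Fin p) ℝ) (j : Fin p) {s : ℕ} (hs : 1 ≤ s) :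
    kappaSparse θ s ≤ ENNReal.ofReal (1 / 4) := by
  have hsingle : kappaSparse θ s ≤ rayleigh θ j (Pi.single j 1) :=
    kappaSparse_le_rayleigh (by simp) (by rwa [nnz_single_one])
  rw [rayleigh_single_one] at hsingle
  exact hsingle.trans (ENNReal.ofReal_le_ofReal (fisher_apply_mem_Icc θ j j j).2)

variable {c₄ : ℝ}

theorem add_zeta_le_sBar (c₄ : ℝ) (θ : Matrix (Fin p) (Fin p) ℝ) (j : Fin p) :
    nnz (column θ j) + zeta c₄ θ j ≤ sBar c₄ θ :=
  (Nat.le_ceil _).trans <| by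
    exact_mod_cast Finset.le_sup (f := fun j : Fin p => ⌈(nnz (column θ j) : ℝ) + zeta c₄ θ j⌉₊)
      (Finset.mem_univ j)

theorem two_mul_nnz_column_add_le_sBar (hc₄ : 0 < c₄) (θ : Matrix (Fin p) (Fin p) ℝ)
    (j : Fin p) :
    2 * nnz (column θ j) + 4 / c₄ + 256 * nnz (column θ j) / (c₄ * (kappaCone θ).toReal) +
      nnz (column θ j) ^ 2 / (32 * c₄ * Real.log p ^ 2) ≤ sBar c₄ θ := by
  have hlog₄ : 0 ≤ Real.log (4 * Real.exp 1) :=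
    Real.log_nonneg (by linarith [Real.add_one_le_exp 1])
  have hdropped : 0 ≤ 2 / c₄ * (1 + Real.log (4 * Real.exp 1) / Real.log p) *
      nnz (column θ j) := by positivity
  have hle := add_zeta_le_sBar c₄ θ j
  rw [zeta, ENNReal.toReal_div, ENNReal.toReal_ofNat] at hle
  calc _ ≤ _ := le_add_of_nonneg_right hdropped
    _ = _ := by ring
    _ ≤ _ := hle

theorem sBar_pos (hc₄ : 0 < c₄) (θ : Matrix (Fin p) (Fin p) ℝ) (j : Fin p) :
    0 < sBar c₄ θ := by
  have hpos : 0 < 2 * nnz (column θ j) + 4 / c₄ +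
      256 * nnz (column θ j) / (c₄ * (kappaCone θ).toReal) +
        nnz (column θ j) ^ 2 / (32 * c₄ * Real.log p ^ 2) := by positivity
  exact_mod_cast hpos.trans_le (two_mul_nnz_column_add_le_sBar hc₄ θ j)

theorem two_mul_nnz_column_le_sBar (hc₄ : 0 < c₄) (θ : Matrix (Fin p) (Fin p) ℝ) (j : Fin p) :
    2 * (nnz (column θ j) : ℝ) ≤ sBar c₄ θ := by
  refine le_trans ?_ (two_mul_nnz_column_add_le_sBar hc₄ θ j)
  rw [add_assoc, add_assoc]
  exact le_add_of_nonneg_right (by positivity)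

theorem nnz_column_le_mul_sBar_mul_kappaCone (hc₄ : 0 < c₄) (hκ : 0 < (kappaCone θ).toReal)
    (j : Fin p) :
    nnz (column θ j) ≤ c₄ / 256 * sBar c₄ θ * (kappaCone θ).toReal := by
  have hterm : 256 * nnz (column θ j) / (c₄ * (kappaCone θ).toReal) ≤ sBar c₄ θ := by
    refine le_trans ?_ (two_mul_nnz_column_add_le_sBar hc₄ θ j)
    rw [add_right_comm]
    exact le_add_of_nonneg_left (by positivity)
  rw [div_le_iff₀ (by positivity)] at hterm
  linarith

theorem nnz_column_sq_le_mul_sBar_mul_log_sq (hc₄ : 0 < c₄) (θ : Matrix (Fin p) (Fin p) ℝ)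
    (j : Fin p) (hp : 0 < Real.log p) :
    (nnz (column θ j) : ℝ) ^ 2 ≤ sBar c₄ θ * (32 * c₄ * Real.log p ^ 2) := by
  rw [← div_le_iff₀ (by positivity)]
  refine le_trans ?_ (two_mul_nnz_column_add_le_sBar hc₄ θ j)
  exact le_add_of_nonneg_left (by positivity)

theorem toReal_kappaSparse_sBar_le (hc₄ : 0 < c₄) (θ : Matrix (Fin p) (Fin p) ℝ) (j : Fin p) :
    (kappaSparse θ (sBar c₄ θ)).toReal ≤ 1 / 4 :=
  ENNReal.toReal_le_of_le_ofReal (by norm_num) (kappaSparse_le_ofReal θ j (sBar_pos hc₄ θ j))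

theorem toReal_kappaMin_le_toReal_kappaSparse (hc₄ : 0 < c₄) (θ : Matrix (Fin p) (Fin p) ℝ)
    (j : Fin p) : (kappaMin c₄ θ).toReal ≤ (kappaSparse θ (sBar c₄ θ)).toReal :=
  ENNReal.toReal_mono
    ((kappaSparse_le_ofReal θ j (sBar_pos hc₄ θ j)).trans_lt ENNReal.ofReal_lt_top).ne
    (min_le_right _ _)

theorem toReal_kappaMin_pos (hc₄ : 0 < c₄) (hκ : 0 < kappaMin c₄ θ) (j : Fin p) :
    0 < (kappaMin c₄ θ).toReal :=
  ENNReal.toReal_pos hκ.ne' (((min_le_right _ _).trans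
    (kappaSparse_le_ofReal θ j (sBar_pos hc₄ θ j))).trans_lt ENNReal.ofReal_lt_top).ne

theorem exists_kappaMin_le_of_mem_cone (hc₄ : 0 < c₄) (hκ : 0 < kappaMin c₄ θ) {u : Fin p → ℝ}
    (hcone : normOn (supp (column θ j))ᶜ u < 7 * normOn (supp (column θ j)) u) :
    ∃ κ : ℝ, (kappaMin c₄ θ).toReal ≤ κ ∧ nnz (column θ j) ≤ c₄ / 256 * sBar c₄ θ * κ ∧
      κ * norm2 u ^ 2 ≤ u ⬝ᵥ fisher θ j *ᵥ u := by
  have hu : u ≠ 0 := by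
    rintro rfl
    simp [normOn] at hcone
  have hle : kappaCone θ ≤ rayleigh θ j u := kappaCone_le_rayleigh hu hcone.le
  have hmin : (kappaMin c₄ θ).toReal ≤ (kappaCone θ).toReal :=
    ENNReal.toReal_mono (hle.trans_lt ENNReal.ofReal_lt_top).ne (min_le_left _ _)
  exact ⟨(kappaCone θ).toReal, hmin,
    nnz_column_le_mul_sBar_mul_kappaCone hc₄ ((toReal_kappaMin_pos hc₄ hκ j).trans_le hmin) j,
    toReal_mul_norm2_sq_le_of_le_rayleigh hle⟩

theorem toReal_kappaSparse_mul_norm2_sq_le_add_norm1_sq (hc₄ : 0 < c₄)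
    (θ : Matrix (Fin p) (Fin p) ℝ) (j : Fin p) (u : Fin p → ℝ) :
    (kappaSparse θ (sBar c₄ θ)).toReal * norm2 u ^ 2 ≤
      u ⬝ᵥ fisher θ j *ᵥ u + norm1 u ^ 2 / (2 * sBar c₄ θ) := by
  have htransfer := norm2_sq_le_quadForm_add_norm1_sq (fun k => (fisher_apply_mem_Icc θ j k k).2)
    (dotProduct_fisher_mulVec_nonneg θ j) (κ := (kappaSparse θ (sBar c₄ θ)).toReal)
    ENNReal.toReal_nonneg (sBar_pos hc₄ θ j)
    (fun x hx => toReal_kappaSparse_mul_norm2_sq_le hx) u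
  exact htransfer.trans_eq (by ring)

end RestrictedEigenvalues

/-! ### Contraction of one column -/

section ColumnContraction

open Matrix

theorem sqrt_natCast_mul (n : ℕ) (x : ℝ) : Real.sqrt (n * x) = n * Real.sqrt (x / n) := by
  rcases eq_or_ne (n : ℝ) 0 with hn | hn
  · simp [hn]
  · rw [← Real.sqrt_sq n.cast_nonneg, ← Real.sqrt_mul (sq_nonneg _), Real.sqrt_sq n.cast_nonneg]
    congr 1
    field_simp

theorem mul_sqrt_div_le_of_sq_mul_le {A s k x n : ℝ} (hA : 0 < A) (hs : 0 ≤ s) (hk : 0 < k)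
    (hn : 0 < n) (h : A ^ 2 * (s / k) ^ 2 * x ≤ n) : s * Real.sqrt (x / n) ≤ k / A := by
  have hsqrt : Real.sqrt ((A * (s / k)) ^ 2 * (x / n)) ≤ 1 := by
    rw [Real.sqrt_le_one, mul_pow, ← mul_div_assoc]
    exact (div_le_one hn).2 h
  rw [Real.sqrt_mul (sq_nonneg _), Real.sqrt_sq (by positivity)] at hsqrt
  rw [le_div_iff₀ hA]
  calc s * Real.sqrt (x / n) * A = A * (s / k) * Real.sqrt (x / n) * k := by field_simp
    _ ≤ k := mul_le_of_le_one_left hk.le hsqrt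

theorem rho_eq (n p : ℕ) : rho n p = 24 * (n * Real.sqrt (Real.log p / n)) := by
  rw [rho, sqrt_natCast_mul]

theorem rho_sq (n p : ℕ) : rho n p ^ 2 = 576 * (n * Real.log p) := by
  rw [rho, mul_pow, Real.sq_sqrt (mul_nonneg n.cast_nonneg (Real.log_natCast_nonneg p))]
  norm_num

variable {p n : ℕ}

/-- The radius `(M / κ₂(s̄)) √(s̄ log p / n)` of the balls on which the columns of the
quasi-posterior concentrate. -/
noncomputable def contractionRadius (c₄ M : ℝ) (n : ℕ) (θ : Matrix (Fin p) (Fin p) ℝ) : ℝ :=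
  M / (kappaSparse θ (sBar c₄ θ)).toReal * Real.sqrt (sBar c₄ θ * Real.log p / n)

variable {c₄ C τ : ℝ} {θ : Matrix (Fin p) (Fin p) ℝ} {z : Fin n → Fin p → Bool}

theorem Regular.dotProduct_fisher_mulVec_le {l : ℝ} (hz : Regular θ l τ z) (hn : 1 ≤ n)
    (j : Fin p) (u : Fin p → ℝ) :
    u ⬝ᵥ fisher θ j *ᵥ u ≤
      (u ⬝ᵥ (∑ i, infoMatrix (column θ j) j (z i)) *ᵥ u) / n + τ * norm1 u ^ 2 := by
  have hn₀ : (0 : ℝ) < n := by exact_mod_cast hn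
  rw [← sub_le_iff_le_add, le_div_iff₀ hn₀]
  linarith [hz.mul_dotProduct_fisher_mulVec_le j u]

theorem Regular.quadForm_div_le (hz : Regular θ (rho n p / 4) τ z) (hn : 1 ≤ n) (j : Fin p)
    {sb : ℝ} {u : Fin p → ℝ}
    (hu : rho n p * norm1 (column θ j + u) - rho n p * norm1 (column θ j) -
        C * sb * Real.log p - rho n p / 4 * norm1 u ≤
      colLogLik z j (column θ j + u) - colLogLik z j (column θ j)) :
    (u ⬝ᵥ (∑ i, infoMatrix (column θ j) j (z i)) *ᵥ u) / n / (2 * (1 + norm1 u)) ≤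
      36 * Real.sqrt (Real.log p / n) * normOn (supp (column θ j)) u -
        12 * Real.sqrt (Real.log p / n) * normOn (supp (column θ j))ᶜ u +
        C * (sb * Real.sqrt (Real.log p / n)) * Real.sqrt (Real.log p / n) := by
  have hn₀ : (0 : ℝ) < n := by exact_mod_cast hn
  have hrho := rho_eq n p
  set r := Real.sqrt (Real.log p / n)
  have hlog : Real.log p = n * r ^ 2 := by
    rw [Real.sq_sqrt (by positivity)]
    field_simp
  have hlik := colLogLik_add_sub_le z j (hz.1 j) u
  have hpenalty := mul_le_mul_of_nonneg_left (norm1_sub_norm1_add_le (column θ j) u)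
    (by rw [hrho]; positivity : 0 ≤ rho n p)
  have hsplit := normOn_add_normOn_compl (supp (column θ j)) u
  rw [div_right_comm, div_le_iff₀ hn₀]
  rw [hrho, hlog] at hu
  rw [hrho] at hlik hpenalty
  have hnr : n * r * norm1 u = n * r * normOn (supp (column θ j)) u +
      n * r * normOn (supp (column θ j))ᶜ u := by rw [← hsplit, mul_add]
  linarith

theorem Regular.norm2_le_contractionRadius
    (hz : Regular θ (rho n p / 4) ((kappaMin c₄ θ).toReal / (64 * sBar c₄ θ)) z)
    (hc₄ : 0 < c₄) (hC : 1 ≤ C) (hp : 0 < Real.log p) (hn : 1 ≤ n) (hκ : 0 < kappaMin c₄ θ)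
    (hn_large : 1296 ^ 2 * (sBar c₄ θ / (kappaMin c₄ θ).toReal) ^ 2 * Real.log p ≤ n)
    {j : Fin p} {u : Fin p → ℝ}
    (hu : rho n p * norm1 (column θ j + u) - rho n p * norm1 (column θ j) -
        C * sBar c₄ θ * Real.log p - rho n p / 4 * norm1 u ≤
      colLogLik z j (column θ j + u) - colLogLik z j (column θ j)) :
    norm2 u ≤ contractionRadius c₄ (l2Const (c₄ / 256) C) n θ := by
  have hn₀ : (0 : ℝ) < n := by exact_mod_cast hn
  have hsb : (0 : ℝ) < sBar c₄ θ := by exact_mod_cast sBar_pos hc₄ θ j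
  have hk := toReal_kappaMin_pos hc₄ hκ j
  have hkks := toReal_kappaMin_le_toReal_kappaSparse hc₄ θ j
  have hks := toReal_kappaSparse_sBar_le hc₄ θ j
  have hcurvature := hz.dotProduct_fisher_mulVec_le hn j u
  have hmain := hz.quadForm_div_le hn j hu
  rw [← normOn_add_normOn_compl (supp (column θ j)) u] at hmain hcurvature
  rw [contractionRadius, mul_div_assoc, Real.sqrt_mul hsb.le]
  refine le_l2Const_mul (by positivity) hC hk hkks hks
    (Real.sqrt_pos.2 (by positivity)) hsb (Nat.cast_nonneg _) (two_mul_nnz_column_le_sBar hc₄ θ j)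
    (mul_sqrt_div_le_of_sq_mul_le (by norm_num) hsb.le hk hn₀ hn_large) (normOn_nonneg _ _)
    (normOn_nonneg _ _) (normOn_supp_sq_le (column θ j) u)
    (div_nonneg (dotProduct_sum_infoMatrix_mulVec_nonneg z (column θ j) u j) hn₀.le)
    (fun hcone => ?_) ?_ hmain
  · obtain ⟨κ, hkκ, hsκ, hκu⟩ := exists_kappaMin_le_of_mem_cone hc₄ hκ hcone
    exact ⟨κ, hkκ, hsκ, hκu.trans (hcurvature.trans_eq (by ring))⟩
  · have htransfer := toReal_kappaSparse_mul_norm2_sq_le_add_norm1_sq hc₄ θ j u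
    rw [← normOn_add_normOn_compl (supp (column θ j)) u] at htransfer
    set L := normOn (supp (column θ j)) u + normOn (supp (column θ j))ᶜ u
    have hslack : (kappaMin c₄ θ).toReal / (64 * sBar c₄ θ) * L ^ 2 ≤
        L ^ 2 / (2 * sBar c₄ θ) := by
      rw [div_mul_eq_mul_div, div_le_div_iff₀ (by positivity) (by positivity)]
      have := mul_le_mul_of_nonneg_right (hkks.trans hks)
        (by positivity : 0 ≤ L ^ 2 * sBar c₄ θ)
      linarith [(by positivity : 0 ≤ L ^ 2 * sBar c₄ θ)]
    have hhalves : L ^ 2 / sBar c₄ θ = L ^ 2 / (2 * sBar c₄ θ) + L ^ 2 / (2 * sBar c₄ θ) := by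
      ring
    linarith

theorem Regular.colLogLik_sub_le (hz : Regular θ (rho n p / 4) τ z) (hp : 0 < Real.log p)
    (hn : 1 ≤ n) (j : Fin p) {u : Fin p → ℝ}
    (hu : norm1 (u - column θ j) ≤ nnz (column θ j) / rho n p) :
    colLogLik z j (column θ j) -
        (nnz (column θ j) / 4 + nnz (column θ j) ^ 2 / (4608 * Real.log p)) ≤
      colLogLik z j u := by
  have hn₀ : (0 : ℝ) < n := by exact_mod_cast hn
  have hrho : 0 < rho n p := by
    unfold rho
    positivity
  have hlik := le_colLogLik_add_sub z j (hz.1 j) (u - column θ j)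
  rw [add_sub_cancel] at hlik
  have hscore : rho n p / 4 * norm1 (u - column θ j) ≤ nnz (column θ j) / 4 := by
    rw [le_div_iff₀ hrho] at hu
    linarith
  have hinfo : n * norm1 (u - column θ j) ^ 2 / 8 ≤
      nnz (column θ j) ^ 2 / (4608 * Real.log p) := by
    calc n * norm1 (u - column θ j) ^ 2 / 8 ≤ n * (nnz (column θ j) / rho n p) ^ 2 / 8 := by
          gcongr
          exact norm1_nonneg _
      _ = nnz (column θ j) ^ 2 / (4608 * Real.log p) := by
          rw [div_pow, rho_sq]
          field_simp
          ring
  linarith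

theorem log_add_nnz_column_le_mul_sBar_mul_log {c₃ : ℝ} (hc₄ : 0 < c₄) (hc₃ : 0 ≤ c₃)
    (hp : 1 ≤ Real.log p) (j : Fin p) :
    3 * Real.log p + nnz (column θ j) * ((c₃ + 2) * Real.log p) +
        (nnz (column θ j) / 4 + nnz (column θ j) ^ 2 / (4608 * Real.log p)) +
        nnz (column θ j) ≤
      (c₃ + c₄ + 7) * sBar c₄ θ * Real.log p := by
  have hp₀ : 0 < Real.log p := one_pos.trans_le hp
  have hsb : (1 : ℝ) ≤ sBar c₄ θ := by exact_mod_cast sBar_pos hc₄ θ j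
  have htwo := mul_le_mul_of_nonneg_right (two_mul_nnz_column_le_sBar hc₄ θ j) hp₀.le
  have hsq := nnz_column_sq_le_mul_sBar_mul_log_sq hc₄ θ j hp₀
  set s : ℝ := (nnz (column θ j) : ℝ)
  set sb : ℝ := (sBar c₄ θ : ℝ)
  have hs : 0 ≤ s := Nat.cast_nonneg _
  have hlog : Real.log p ≤ sb * Real.log p := le_mul_of_one_le_left hp₀.le hsb
  have hslog : s ≤ s * Real.log p := le_mul_of_one_le_right hs hp
  have hquad : s ^ 2 / (4608 * Real.log p) ≤ c₄ * (sb * Real.log p) := by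
    rw [div_le_iff₀ (by positivity)]
    linarith [(by positivity : 0 ≤ c₄ * sb * Real.log p ^ 2)]
  have hc₃s := mul_le_mul_of_nonneg_left htwo hc₃
  have hc₃sb : 0 ≤ c₃ * (sb * Real.log p) := by positivity
  linarith

theorem Regular.quasiPosterior_column_far_le {c₁ c₂ c₃ : ℝ} {g : ℕ → ℝ}
    (hz : Regular θ (rho n p / 4) ((kappaMin c₄ θ).toReal / (64 * sBar c₄ θ)) z)
    (hg : SparsityPrior p c₁ c₂ c₃ c₄ g) (hc₁ : 0 < c₁) (hc₂ : 0 ≤ c₂) (hc₄ : 0 < c₄)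
    (hc₃ : 0 ≤ c₃) (hp : 3 ≤ p) (hpc₁ : 1 / c₁ ≤ p) (hpc₂ : 8 * c₂ ≤ (p : ℝ) ^ c₄) (hn : 1 ≤ n)
    (hκ : 0 < kappaMin c₄ θ)
    (hn_large : 1296 ^ 2 * (sBar c₄ θ / (kappaMin c₄ θ).toReal) ^ 2 * Real.log p ≤ n)
    (j : Fin p) :
    quasiPosterior g (rho n p) z
        {ϑ | contractionRadius c₄ (l2Const (c₄ / 256) (c₃ + c₄ + 7)) n θ <
          norm2 (column ϑ j - column θ j)} ≤ ENNReal.ofReal ((p : ℝ) ^ 2)⁻¹ := by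
  have hlog : 1 ≤ Real.log p := by
    rw [Real.le_log_iff_exp_le (by positivity)]
    have hp' : (3 : ℝ) ≤ p := by exact_mod_cast hp
    linarith [Real.exp_one_lt_three]
  have hlog₀ : 0 < Real.log p := one_pos.trans_le hlog
  have hrho : 0 < rho n p := by
    unfold rho
    positivity
  have hA : MeasurableSet {u : Fin p → ℝ |
      contractionRadius c₄ (l2Const (c₄ / 256) (c₃ + c₄ + 7)) n θ < norm2 (u - column θ j)} :=
    measurableSet_lt measurable_const (measurable_norm2.comp (measurable_id.sub_const _))
  refine quasiPosterior_column_mem_le hA <|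
    setLIntegral_exp_columnPrior_le_mul hg.nonneg hrho (by positivity) hA
      (fun u hu => hz.colLogLik_sub_le hlog₀ hn j hu) (fun u hu => ?_)
      (hg.exp_neg_mul_sum_le hc₁ hc₂ (by omega) hpc₁ hpc₂
        ((Finset.card_filter_le _ _).trans_eq (by simp))
        (log_add_nnz_column_le_mul_sBar_mul_log hc₄ hc₃ hlog j))
  by_contra! hlik
  refine hu.not_ge <|
    hz.norm2_le_contractionRadius (j := j) hc₄ (by linarith) hlog₀ hn hκ hn_large ?_
  rw [add_sub_cancel]
  exact hlik.le

end ColumnContraction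

/-! ### Contraction in expectation -/

section ExpectedContraction

variable {p n : ℕ} {c₄ : ℝ} {θ : Matrix (Fin p) (Fin p) ℝ}

theorem setOf_lt_maxColNorm_subset_iUnion {r : ℝ} (hp : 1 ≤ p) :
    {ϑ | r < maxColNorm (ϑ - θ)} ⊆ ⋃ j, {ϑ | r < norm2 (column ϑ j - column θ j)} := by
  have : Nonempty (Fin p) := ⟨⟨0, hp⟩⟩
  intro ϑ hϑ
  obtain ⟨j, hj⟩ :=
    exists_lt_of_lt_ciSup (show r < ⨆ j, norm2 (column (ϑ - θ) j) from hϑ)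
  exact Set.mem_iUnion.2 ⟨j, hj⟩

theorem dataLaw_not_regular_le_four_div (hc₄ : 0 < c₄) (hθ : θ.IsSymm) (hp : 1 ≤ p) (hn : 1 ≤ n)
    (hκ : 0 < kappaMin c₄ θ)
    (hn_large : 1296 ^ 2 * (sBar c₄ θ / (kappaMin c₄ θ).toReal) ^ 2 * Real.log p ≤ n) :
    dataLaw n θ {z | ¬ Regular θ (rho n p / 4)
      ((kappaMin c₄ θ).toReal / (64 * sBar c₄ θ)) z} ≤ ENNReal.ofReal (4 / p) := by
  have hsb : (0 : ℝ) < sBar c₄ θ := by exact_mod_cast sBar_pos hc₄ θ ⟨0, hp⟩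
  have hk := toReal_kappaMin_pos hc₄ hκ ⟨0, hp⟩
  have hlog : 0 ≤ Real.log p := Real.log_natCast_nonneg p
  refine dataLaw_not_regular_le hθ hp hn (by unfold rho; positivity) (by positivity) ?_ ?_
  · rw [div_pow, rho_sq]
    linarith [mul_nonneg n.cast_nonneg hlog]
  · calc 8 * Real.log p ≤ 1296 ^ 2 / 64 ^ 2 * Real.log p := by
          gcongr
          norm_num
      _ = 1296 ^ 2 * (sBar c₄ θ / (kappaMin c₄ θ).toReal) ^ 2 * Real.log p *
          ((kappaMin c₄ θ).toReal / (64 * sBar c₄ θ)) ^ 2 := by field_simp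
      _ ≤ n * ((kappaMin c₄ θ).toReal / (64 * sBar c₄ θ)) ^ 2 := by gcongr

theorem lintegral_le_add_measure {α : Type*} [MeasurableSpace α] {μ : Measure α}
    [IsProbabilityMeasure μ] {f : α → ENNReal} {s : Set α} {ε : ENNReal} (hs : MeasurableSet s)
    (hf : ∀ x, f x ≤ 1) (hε : ∀ x ∉ s, f x ≤ ε) : ∫⁻ x, f x ∂μ ≤ ε + μ s := by
  calc ∫⁻ x, f x ∂μ ≤ ∫⁻ x, (ε + s.indicator 1 x) ∂μ := by
        refine lintegral_mono fun x => ?_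
        by_cases hx : x ∈ s
        · rw [Set.indicator_of_mem hx]
          exact (hf x).trans le_add_self
        · rw [Set.indicator_of_notMem hx, add_zero]
          exact hε x hx
    _ = ε + μ s := by
        rw [lintegral_add_left measurable_const, lintegral_const, measure_univ, mul_one,
          lintegral_indicator_one hs]

theorem lintegral_quasiPosterior_maxColNorm_le {c₁ c₂ c₃ : ℝ} {g : ℕ → ℝ}
    (hg : SparsityPrior p c₁ c₂ c₃ c₄ g) (hc₁ : 0 < c₁) (hc₂ : 0 ≤ c₂) (hc₄ : 0 < c₄)
    (hc₃ : 0 ≤ c₃) (hp : 3 ≤ p) (hpc₁ : 1 / c₁ ≤ p) (hpc₂ : 8 * c₂ ≤ (p : ℝ) ^ c₄)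
    (hθ : θ.IsSymm) (hκ : 0 < kappaMin c₄ θ)
    (hn_large : 1296 ^ 2 * (sBar c₄ θ / (kappaMin c₄ θ).toReal) ^ 2 * Real.log p ≤ n) :
    ∫⁻ z, quasiPosterior g (rho n p) z
        {ϑ | contractionRadius c₄ (l2Const (c₄ / 256) (c₃ + c₄ + 7)) n θ < maxColNorm (ϑ - θ)}
        ∂dataLaw n θ ≤ ENNReal.ofReal (5 / p) := by
  have hp₀ : 1 ≤ p := by omega
  have hn : 1 ≤ n := by
    have hsb : (0 : ℝ) < sBar c₄ θ := by exact_mod_cast sBar_pos hc₄ θ ⟨0, hp₀⟩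
    have hk := toReal_kappaMin_pos hc₄ hκ ⟨0, hp₀⟩
    have hlog : 0 < Real.log p := Real.log_pos (by exact_mod_cast (by omega : 1 < p))
    have hn₀ : (0 : ℝ) < n := lt_of_lt_of_le (by positivity) hn_large
    exact_mod_cast hn₀
  have hregular (z : Fin n → Fin p → Bool)
      (hz : Regular θ (rho n p / 4) ((kappaMin c₄ θ).toReal / (64 * sBar c₄ θ)) z) :
      quasiPosterior g (rho n p) z {ϑ | contractionRadius c₄ (l2Const (c₄ / 256)
        (c₃ + c₄ + 7)) n θ < maxColNorm (ϑ - θ)} ≤ ENNReal.ofReal (1 / p) := by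
    refine (measure_mono (setOf_lt_maxColNorm_subset_iUnion hp₀)).trans <|
      (measure_iUnion_le_card_mul _ fun j => hz.quasiPosterior_column_far_le hg hc₁ hc₂ hc₄ hc₃ hp
        hpc₁ hpc₂ hn hκ hn_large j).trans_eq ?_
    rw [Fintype.card_fin, ← ENNReal.ofReal_natCast, ← ENNReal.ofReal_mul p.cast_nonneg]
    congr 1
    field_simp
  calc _ ≤ ENNReal.ofReal (1 / p) + dataLaw n θ {z | ¬ Regular θ (rho n p / 4)
        ((kappaMin c₄ θ).toReal / (64 * sBar c₄ θ)) z} :=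
        lintegral_le_add_measure (Set.toFinite _).measurableSet
          (fun z => quasiPosterior_le_one g _ z _) fun z hz => hregular z (not_not.1 hz)
    _ ≤ ENNReal.ofReal (1 / p) + ENNReal.ofReal (4 / p) := by
        gcongr
        exact dataLaw_not_regular_le_four_div hc₄ hθ hp₀ hn hκ hn_large
    _ = ENNReal.ofReal (5 / p) := by
        rw [← ENNReal.ofReal_add (by positivity) (by positivity), ← add_div]
        norm_num

end ExpectedContraction

end IsingQuasi

theorem theorem4 :
    ∃ A₁ A₂ : ℝ, 0 < A₁ ∧ 0 < A₂ ∧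
      ∀ c₁ c₂ c₃ c₄ : ℝ, 0 < c₁ → 0 < c₂ → 0 < c₄ → c₄ ≤ c₃ →
        ∃ M₀ : ℝ, 2 < M₀ ∧
          ∃ p₀ : ℕ, ∀ p : ℕ, p₀ ≤ p →
            ∀ g : ℕ → ℝ, IsingQuasi.SparsityPrior p c₁ c₂ c₃ c₄ g →
            ∀ θs : Matrix (Fin p) (Fin p) ℝ, θs.IsSymm →
            0 < IsingQuasi.kappaMin c₄ θs →
            ∀ n : ℕ,
              A₁ * ((IsingQuasi.sBar c₄ θs : ℝ) / (IsingQuasi.kappaMin c₄ θs).toReal) ^ 2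
                  * Real.log p ≤ n →
              ∫⁻ z : Fin n → Fin p → Bool,
                  IsingQuasi.quasiPosterior g (IsingQuasi.rho n p) z
                    {θ | M₀ / (IsingQuasi.kappaSparse θs (IsingQuasi.sBar c₄ θs)).toReal
                        * Real.sqrt (IsingQuasi.sBar c₄ θs * Real.log p / n)
                        < IsingQuasi.maxColNorm (θ - θs)}
                  ∂(IsingQuasi.dataLaw n θs)
                ≤ ENNReal.ofReal (2 * Real.exp (-A₂ * n) + 12 / p) := by
  refine ⟨1296 ^ 2, 1, by norm_num, one_pos, fun c₁ c₂ c₃ c₄ hc₁ hc₂ hc₄ hc₄₃ => ?_⟩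
  have hc₃ : 0 ≤ c₃ := hc₄.le.trans hc₄₃
  have hM := IsingQuasi.three_le_l2Const (c := c₄ / 256) (C := c₃ + c₄ + 7)
    (by positivity) (by positivity)
  obtain ⟨p₀, hp₀⟩ := Filter.eventually_atTop.1 <|
    (Filter.eventually_ge_atTop 3).and <|
      ((tendsto_natCast_atTop_atTop (R := ℝ)).eventually_ge_atTop (1 / c₁)).and <|
        ((tendsto_rpow_atTop hc₄).comp tendsto_natCast_atTop_atTop).eventually_ge_atTop (8 * c₂)
  refine ⟨IsingQuasi.l2Const (c₄ / 256) (c₃ + c₄ + 7), by linarith, p₀,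
    fun p hp g hg θs hθs hκ n hn => ?_⟩
  obtain ⟨hp₃, hpc₁, hpc₂⟩ := hp₀ p hp
  refine (IsingQuasi.lintegral_quasiPosterior_maxColNorm_le hg hc₁ hc₂.le hc₄ hc₃ hp₃ hpc₁ hpc₂
    hθs hκ hn).trans (ENNReal.ofReal_le_ofReal ?_)
  calc (5 : ℝ) / p ≤ 12 / p := by gcongr; norm_num
    _ ≤ 2 * Real.exp (-1 * n) + 12 / p := le_add_of_nonneg_left (by positivity)
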